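/- \textbf{Notation.} Write vectors of length $4$ as rows $n=(n_1,n_2)$ with $n_1,n_2$ of length $2$, and let $\omega(m,n)=m_1\cdot n_2-m_2\cdot n_1$. For an odd prime $N$ let $\mathcal H_N=L^2((\mathbb Z/N\mathbb Z)^2)$ with $\langle\phi,\psi\rangle=N^{-2}\sum_y\phi(y)\overline{\psi(y)}$. For $n\in\mathbb Z^4$ let $T_N(n)$ be the operator $$(T_N(n)\psi)(y)=e^{\pi i\,n_1\cdot n_2/N}\,e^{2\pi i\,n_2\cdot y/N}\,\psi(y+n_1),$$ which depends only on $n$ modulo $2N$, and for $f$ on $\mathbb T^4=\mathbb R^4/\mathbb Z^4$ put $\mathrm{Op}_N(f)=\sum_{n\in\mathbb Z^4}\hat f(n)T_N(n)$. For $B\in \mathrm{Sp}(4,\mathbb Z/N\mathbb Z)$ let $\bar B\in\mathrm{Sp}(4,\mathbb Z/2N\mathbb Z)$ be its lift with $\bar B\equiv I\pmod 2$; a quantization $U_N(B)$ is a unitary operator on $\mathcal H_N$ with $U_N(B)^{-1}T_N(n)U_N(B)=T_N(n\bar B)$ for all $n\in\mathbb Z^4$ (it exists and is unique up to a phase). For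 $A\in \mathrm{Sp}(4,\mathbb Z)$, a Hecke group $C(N,A)$ is a maximal commutative subgroup of $\mathrm{Sp}(4,\mathbb Z/N\mathbb Z)$ containing $A$ modulo $N$, and a Hecke basis is an orthonormal basis $\phi_1,\dots,\phi_{N^2}$ of $\mathcal H_N$ consisting of joint eigenfunctions of all $U_N(B)$, $B\in C(N,A)$. The quantum variance in this basis is $$S_2(f,N)=\frac1{N^2}\sum_{j=1}^{N^2}\Big|\langle \mathrm{Op}_N(f)\phi_j,\phi_j\rangle-\int_{\mathbb T^4}f\Big|^2 .$$ \textbf{Theorem 1.} Let $A\in \mathrm{Sp}(4,\mathbb Z)$, $A\equiv I\pmod 2$, have $4$ distinct eigenvalues, none of which is a root of unity. Suppose that $\mathbb Q^4=V_1\oplus V_2$ with $V_1,V_2$ nonzero rational symplectic subspaces that are orthogonal with respect to $\omega$ and invariant under the action $v\mapsto vA$ on row vectors, and let $Z_i=V_i\cap\mathbb Z^4$. Let $n\in\mathbb Z^4$, $n\neq0$, and $f(x)=e^{2\pi i\,n\cdot x}$. Then, as $N\to\infty$ through primes, for any Hecke group $C(N,A)$ and any Hecke basis, $$S_2(f,N)=\begin{cases}\dfrac1N+O\!\left(\dfrac1{N^2}\right)&\text{if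 } n\in Z_1\cup Z_2,\\[2mm] \dfrac1{N^2}+O\!\left(\dfrac1{N^3}\right)&\text{otherwise,}\end{cases}$$ where the implied constants do not depend on $N$, on the Hecke group or on the Hecke basis. -/

import Mathlib

open scoped Matrix ComplexConjugate
open MeasureTheory

namespace CatMap

/-- Row vectors of length four over `R`, written `n = (n₁, n₂)` with `n₁, n₂ ∈ R²`. -/
abbrev Vec (R : Type*) := Fin 2 ⊕ Fin 2 → R

/-- The symplectic inner product `ω(m, n) = m₁ · n₂ - m₂ · n₁`. -/
def omega {R : Type*} [CommRing R] (m n : Vec R) : R :=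
  (m ∘ Sum.inl) ⬝ᵥ (n ∘ Sum.inr) - (m ∘ Sum.inr) ⬝ᵥ (n ∘ Sum.inl)

/-- The group `Sp(4, R)`. -/
abbrev Sp4 (R : Type*) [CommRing R] := Matrix.symplecticGroup (Fin 2) R

/-- Coordinatewise reduction modulo `N` of an integer vector. -/
def redVec {ι : Type*} (N : ℕ) (n : ι → ℤ) : ι → ZMod N := fun i => (n i : ZMod N)

/-- Reduction modulo `N`, as a map `Sp(4, ℤ) → Sp(4, ℤ/N)`. -/
def redSp (N : ℕ) (A : Sp4 ℤ) : Sp4 (ZMod N) :=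
  ⟨A.1.map (Int.castRingHom (ZMod N)),
    SymplecticGroup.map_mem (f := Int.castRingHom (ZMod N)) A.2⟩

/-- The state space `H_N = L²((ℤ/N)²)`. -/
abbrev State (N : ℕ) := (Fin 2 → ZMod N) → ℂ

/-- The inner product `⟨φ, ψ⟩ = N⁻² ∑_y φ(y) conj (ψ(y))`. -/
noncomputable def hInner {N : ℕ} [NeZero N] (φ ψ : State N) : ℂ :=
  (1 / (N : ℂ) ^ 2) * ∑ y, φ y * conj (ψ y)

/-- The elementary operator
`(T_N(n) ψ)(y) = exp(πi n₁·n₂ / N) exp(2πi n₂·y / N) ψ(y + n₁)`. -/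
noncomputable def T (N : ℕ) [NeZero N] (n : Vec ℤ) : State N →ₗ[ℂ] State N where
  toFun ψ y :=
    Complex.exp (Real.pi * Complex.I * (((n ∘ Sum.inl) ⬝ᵥ (n ∘ Sum.inr) : ℤ) : ℂ) / N) *
      ZMod.stdAddChar (redVec N (n ∘ Sum.inr) ⬝ᵥ y) * ψ (y + redVec N (n ∘ Sum.inl))
  map_add' φ ψ := by
    funext y
    simp only [Pi.add_apply]
    ring
  map_smul' c ψ := by
    funext y
    simp only [Pi.smul_apply, smul_eq_mul, RingHom.id_apply]
    ring

/-- The quantization `Op_N(f) = ∑_n f̂(n) T_N(n)` of an observable on the torus `𝕋⁴`. -/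
noncomputable def Op (N : ℕ) [NeZero N] (f : UnitAddTorus (Fin 2 ⊕ Fin 2) → ℂ) (φ : State N) :
    State N :=
  ∑' n : Vec ℤ, UnitAddTorus.mFourierCoeff f n • T N n φ

/-- The mean `∫_{𝕋⁴} f` with respect to the normalized Haar measure. -/
noncomputable def torusMean (f : UnitAddTorus (Fin 2 ⊕ Fin 2) → ℂ) : ℂ :=
  ∫ x, f x ∂(Measure.pi fun _ : Fin 2 ⊕ Fin 2 => (AddCircle.haarAddCircle : Measure UnitAddCircle))

/-- `U` is a quantization `U_N(B)` of `B ∈ Sp(4, ℤ/N)` (`N` odd): a unitary operator on `H_N`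
satisfying the exact Egorov identity `U⁻¹ T_N(n) U = T_N(n B̄)` for all `n`, where
`B̄ ∈ Sp(4, ℤ/2N)` is the lift of `B` that is congruent to `I` modulo `2`.
As `T_N(m)` only depends on `m` modulo `2N`, the vector `n B̄` is represented by any
integer vector `m` with `m ≡ n B (mod N)` and `m ≡ n (mod 2)`.
Such a `U` is unique up to a phase. -/
def IsQuantization (N : ℕ) [NeZero N] (B : Sp4 (ZMod N)) (U : State N ≃ₗ[ℂ] State N) : Prop :=
  (∀ φ ψ, hInner (U φ) (U ψ) = hInner φ ψ) ∧
  ∀ n m : Vec ℤ, redVec N m = redVec N n ᵥ* B.1 → redVec 2 m = redVec 2 n →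
    ∀ φ, U.symm (T N n (U φ)) = T N m φ

/-! Existence of the quantization `U_N(B)` for odd `N`. -/

section Existence

set_option linter.unusedSectionVars false

variable {N : ℕ} [NeZero N]

/-- The operator `ψ ↦ e_N(v₁·v₂/2 + v₂·y) ψ(y + v₁)` for `v` modulo `N`, with `1/2` in `ℤ/N`. -/
noncomputable def W (v : Vec (ZMod N)) : Module.End ℂ (State N) where
  toFun ψ y :=
    ZMod.stdAddChar ((2 : ZMod N)⁻¹ * ((v ∘ Sum.inl) ⬝ᵥ (v ∘ Sum.inr)) + (v ∘ Sum.inr) ⬝ᵥ y) *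
      ψ (y + v ∘ Sum.inl)
  map_add' φ ψ := by
    funext y
    simp only [Pi.add_apply]
    ring
  map_smul' c ψ := by
    funext y
    simp only [Pi.smul_apply, smul_eq_mul, RingHom.id_apply]
    ring

theorem W_apply (v : Vec (ZMod N)) (ψ : State N) (y : Fin 2 → ZMod N) :
    W v ψ y = ZMod.stdAddChar ((2 : ZMod N)⁻¹ * ((v ∘ Sum.inl) ⬝ᵥ (v ∘ Sum.inr)) +
      (v ∘ Sum.inr) ⬝ᵥ y) * ψ (y + v ∘ Sum.inl) := rfl

theorem two_mul_inv (hN : Odd N) : (2 : ZMod N) * 2⁻¹ = 1 := by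
  have := ZMod.coe_mul_inv_eq_one (n := N) 2 (Nat.coprime_two_left.2 hN)
  simpa using this

theorem omega_self (u : Vec (ZMod N)) : omega u u = 0 := by
  simp only [omega, dotProduct, Fin.sum_univ_two, Function.comp_apply]; ring

theorem omega_neg (u v : Vec (ZMod N)) : omega u (-v) = -omega u v := by
  simp only [omega, dotProduct, Fin.sum_univ_two, Function.comp_apply, Pi.neg_apply]; ring

theorem omega_add (u v w : Vec (ZMod N)) : omega u (v + w) = omega u v + omega u w := by
  simp only [omega, dotProduct, Fin.sum_univ_two, Function.comp_apply, Pi.add_apply]; ring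

theorem omega_add_left (u v w : Vec (ZMod N)) : omega (v + w) u = omega v u + omega w u := by
  simp only [omega, dotProduct, Fin.sum_univ_two, Function.comp_apply, Pi.add_apply]; ring

theorem omega_neg_left (u v : Vec (ZMod N)) : omega (-u) v = -omega u v := by
  simp only [omega, dotProduct, Fin.sum_univ_two, Function.comp_apply, Pi.neg_apply]; ring

theorem omega_comm (u v : Vec (ZMod N)) : omega u v = -omega v u := by
  simp only [omega, dotProduct, Fin.sum_univ_two, Function.comp_apply]; ring

theorem omega_eq_J (u v : Vec (ZMod N)) :
    omega u v = - (u ⬝ᵥ (Matrix.J (Fin 2) (ZMod N) *ᵥ v)) := by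
  simp [omega, dotProduct, Matrix.J, Matrix.mulVec, Fintype.sum_sum_type, Matrix.one_apply]
  ring

theorem omega_sp (B : Sp4 (ZMod N)) (u v : Vec (ZMod N)) :
    omega (u ᵥ* B.1) (v ᵥ* B.1) = omega u v := by
  have h := SymplecticGroup.mem_iff.1 B.2
  rw [omega_eq_J, omega_eq_J]
  conv_rhs => rw [← h]
  rw [← Matrix.mulVec_transpose B.1 v, ← Matrix.dotProduct_mulVec,
    Matrix.mulVec_mulVec, Matrix.mulVec_mulVec]

theorem W_mul (hN : Odd N) (u v : Vec (ZMod N)) :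
    W u * W v = (ZMod.stdAddChar ((2 : ZMod N)⁻¹ * omega u v) : ℂ) • W (u + v) := by
  refine LinearMap.ext fun ψ => funext fun y => ?_
  simp only [Module.End.mul_apply, LinearMap.smul_apply, Pi.smul_apply, W_apply, smul_eq_mul]
  rw [← mul_assoc, ← mul_assoc, ← AddChar.map_add_eq_mul, ← AddChar.map_add_eq_mul]
  have h2 := two_mul_inv hN
  congr 2
  · simp only [omega, dotProduct, Fin.sum_univ_two, Function.comp_apply, Pi.add_apply]
    linear_combination -(v (Sum.inr 0) * u (Sum.inl 0) + v (Sum.inr 1) * u (Sum.inl 1)) * h2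
  · funext i
    simp only [Pi.add_apply, Function.comp_apply]
    ring

theorem W_zero : W (0 : Vec (ZMod N)) = 1 := by
  refine LinearMap.ext fun ψ => funext fun y => ?_
  have h : ∀ i : Fin 2 → Fin 2 ⊕ Fin 2, (0 : Vec (ZMod N)) ∘ i = 0 := fun _ => rfl
  simp [W_apply, h]

theorem hInner_W (hN : Odd N) (v : Vec (ZMod N)) (φ ψ : State N) :
    hInner (W v φ) ψ = hInner φ (W (-v) ψ) := by
  simp only [hInner]
  congr 1
  refine Fintype.sum_equiv (Equiv.addRight (v ∘ Sum.inl)) _ _ fun y => ?_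
  simp only [W_apply, Equiv.coe_addRight, map_mul]
  have : conj (ZMod.stdAddChar ((2 : ZMod N)⁻¹ * (((-v) ∘ Sum.inl) ⬝ᵥ ((-v) ∘ Sum.inr)) +
      ((-v) ∘ Sum.inr) ⬝ᵥ (y + v ∘ Sum.inl)) : ℂ) =
      ZMod.stdAddChar ((2 : ZMod N)⁻¹ * ((v ∘ Sum.inl) ⬝ᵥ (v ∘ Sum.inr)) +
      (v ∘ Sum.inr) ⬝ᵥ y) := by
    rw [ZMod.stdAddChar_apply, ← Circle.coe_inv_eq_conj, ← AddChar.map_neg_eq_inv,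
      ← ZMod.stdAddChar_apply]
    congr 1
    simp only [dotProduct, Fin.sum_univ_two, Function.comp_apply, Pi.add_apply, Pi.neg_apply]
    linear_combination -(v (Sum.inr 0) * v (Sum.inl 0) + v (Sum.inr 1) * v (Sum.inl 1)) *
      two_mul_inv hN
  rw [this]
  have h : y + v ∘ Sum.inl + (-v) ∘ Sum.inl = y := by
    funext i; simp
  rw [h]
  ring

theorem exp_half (hN : Odd N) (k : ℤ) :
    Complex.exp (Real.pi * Complex.I * (k : ℂ) / N) =
      (-1 : ℂ) ^ k * ZMod.stdAddChar ((2 : ZMod N)⁻¹ * (k : ZMod N)) := by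
  obtain ⟨r, hr⟩ := hN
  have hinv : (2 : ZMod N)⁻¹ = ((r + 1 : ℤ) : ZMod N) := by
    have h1 := two_mul_inv (N := N) ⟨r, hr⟩
    have h2 : (2 : ZMod N) * ((r + 1 : ℤ) : ZMod N) = 1 := by
      have : ((N : ℕ) : ZMod N) = 0 := ZMod.natCast_self N
      have h3 : ((2 * r + 1 : ℕ) : ZMod N) = 0 := by rw [← hr]; exact this
      push_cast at h3 ⊢
      linear_combination h3
    linear_combination ((r + 1 : ℤ) : ZMod N) * h1 - (2 : ZMod N)⁻¹ * h2
  have hN0 : (N : ℂ) ≠ 0 := Nat.cast_ne_zero.2 (NeZero.ne N)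
  have hNr : (N : ℂ) = 2 * r + 1 := by rw [hr]; push_cast; rfl
  rw [hinv, ← Int.cast_mul, ZMod.stdAddChar_coe, ← Complex.exp_pi_mul_I, ← Complex.exp_int_mul,
    ← Complex.exp_add]
  rw [Complex.exp_eq_exp_iff_exists_int]
  refine ⟨-k, ?_⟩
  field_simp
  push_cast
  rw [hNr]
  ring

theorem T_eq_W (hN : Odd N) (n : Vec ℤ) :
    T N n = ((-1 : ℂ) ^ ((n ∘ Sum.inl) ⬝ᵥ (n ∘ Sum.inr))) • W (redVec N n) := by
  refine LinearMap.ext fun ψ => funext fun y => ?_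
  simp only [LinearMap.smul_apply, Pi.smul_apply, W_apply, smul_eq_mul, T, LinearMap.coe_mk,
    AddHom.coe_mk]
  rw [exp_half hN, AddChar.map_add_eq_mul]
  have h1 : (((n ∘ Sum.inl) ⬝ᵥ (n ∘ Sum.inr) : ℤ) : ZMod N) =
      (redVec N n ∘ Sum.inl) ⬝ᵥ (redVec N n ∘ Sum.inr) := by
    simp [dotProduct, redVec]
  have h2 : redVec N (n ∘ Sum.inr) = redVec N n ∘ Sum.inr := rfl
  have h3 : redVec N (n ∘ Sum.inl) = redVec N n ∘ Sum.inl := rfl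
  rw [h1, h2, h3]
  ring

theorem sign_eq {n m : Vec ℤ} (h : redVec 2 m = redVec 2 n) :
    (-1 : ℂ) ^ ((n ∘ Sum.inl) ⬝ᵥ (n ∘ Sum.inr)) = (-1 : ℂ) ^ ((m ∘ Sum.inl) ⬝ᵥ (m ∘ Sum.inr)) := by
  have hc : (((n ∘ Sum.inl) ⬝ᵥ (n ∘ Sum.inr) : ℤ) : ZMod 2) =
      (((m ∘ Sum.inl) ⬝ᵥ (m ∘ Sum.inr) : ℤ) : ZMod 2) := by
    have hi : ∀ i, ((m i : ℤ) : ZMod 2) = ((n i : ℤ) : ZMod 2) := fun i => congrFun h i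
    simp [dotProduct, hi]
  have hd := (ZMod.intCast_eq_intCast_iff_dvd_sub _ _ 2).1 hc
  obtain ⟨c, hc⟩ := hd
  have : (m ∘ Sum.inl) ⬝ᵥ (m ∘ Sum.inr) = (n ∘ Sum.inl) ⬝ᵥ (n ∘ Sum.inr) + 2 * c := by
    push_cast at hc; linarith
  rw [this, zpow_add₀ (by norm_num), zpow_mul]
  norm_num

theorem W_conj (hN : Odd N) (w v : Vec (ZMod N)) :
    W w * W v = (ZMod.stdAddChar (omega w v) : ℂ) • (W v * W w) := by
  rw [W_mul hN, W_mul hN, smul_smul, ← AddChar.map_add_eq_mul, add_comm v w]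
  congr 2
  rw [omega_comm v w]
  linear_combination (omega w v) * two_mul_inv hN

theorem W_mul_neg (hN : Odd N) (u : Vec (ZMod N)) : W u * W (-u) = 1 := by
  rw [W_mul hN, omega_neg, omega_self]
  simp [W_zero]

/-- For odd `N` every `B ∈ Sp(4, ℤ/N)` has a quantization `U_N(B)`. -/
theorem exists_isQuantization (hN : Odd N) (B : Sp4 (ZMod N)) :
    ∃ U, IsQuantization N B U := by
  set U₀ : Module.End ℂ (State N) := ∑ u : Vec (ZMod N), W u * W (-(u ᵥ* B.1)) with hU₀
  set U₁ : Module.End ℂ (State N) := ∑ u : Vec (ZMod N), W (u ᵥ* B.1) * W (-u) with hU₁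
  have hint : ∀ v, W v * U₀ = U₀ * W (v ᵥ* B.1) := by
    intro v
    rw [hU₀, Finset.mul_sum, Finset.sum_mul]
    refine Fintype.sum_equiv (Equiv.addLeft v) _ _ fun u => ?_
    rw [Equiv.coe_addLeft, ← mul_assoc, W_mul hN, mul_assoc, W_mul hN, Matrix.add_vecMul,
      smul_mul_assoc]
    have e : -(v ᵥ* B.1 + u ᵥ* B.1) + v ᵥ* B.1 = -(u ᵥ* B.1) := by abel
    rw [e, mul_smul_comm]
    congr 2
    rw [omega_neg_left, omega_add_left, omega_self, omega_sp, zero_add, omega_comm u v, neg_neg]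
  set F : Finset (Vec (ZMod N)) := Finset.univ.filter fun u => u ᵥ* B.1 = u with hF
  have hprod : U₀ * U₁ = ((N : ℂ) ^ 4 * F.card) • (1 : Module.End ℂ (State N)) := by
    have h1 : U₀ * U₁ = ∑ u : Vec (ZMod N), ∑ w : Vec (ZMod N),
        (ZMod.stdAddChar (omega w (u - u ᵥ* B.1)) : ℂ) • (W u * W (-(u ᵥ* B.1))) := by
      rw [Finset.sum_comm, hU₁, Finset.mul_sum]
      refine Finset.sum_congr rfl fun w _ => ?_
      rw [← mul_assoc, ← hint, hU₀, Finset.mul_sum, Finset.sum_mul]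
      refine Finset.sum_congr rfl fun u _ => ?_
      rw [W_mul hN u, mul_smul_comm, W_conj hN w, smul_mul_assoc, smul_mul_assoc, mul_assoc,
        W_mul_neg hN, mul_one, ← sub_eq_add_neg, smul_comm]
    have h2 : ∀ d : Vec (ZMod N), d ≠ 0 →
        ∑ w : Vec (ZMod N), (ZMod.stdAddChar (omega w d) : ℂ) = 0 := by
      intro d hd
      let ψ : AddChar (Vec (ZMod N)) ℂ :=
        { toFun := fun w => ZMod.stdAddChar (omega w d)
          map_zero_eq_one' := by simp [omega, dotProduct]
          map_add_eq_mul' := fun a b => by rw [omega_add_left, AddChar.map_add_eq_mul] }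
      refine AddChar.sum_eq_zero_of_ne_one (ψ := ψ) fun h => hd ?_
      have hz : ∀ w, omega w d = 0 := fun w => by
        refine ZMod.injective_stdAddChar ?_
        rw [AddChar.map_zero_eq_one]
        exact DFunLike.congr_fun h w
      funext i
      rcases i with i | i
      · have := hz (Pi.single (Sum.inr i) 1)
        fin_cases i <;> simpa [omega, dotProduct, Pi.single_apply] using this
      · have := hz (Pi.single (Sum.inl i) 1)
        fin_cases i <;> simpa [omega, dotProduct, Pi.single_apply] using this
    have h3 : ∀ u : Vec (ZMod N), ∑ w : Vec (ZMod N),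
        (ZMod.stdAddChar (omega w (u - u ᵥ* B.1)) : ℂ) • (W u * W (-(u ᵥ* B.1))) =
        if u ᵥ* B.1 = u then ((N : ℂ) ^ 4) • (1 : Module.End ℂ (State N)) else 0 := by
      intro u
      rw [← Finset.sum_smul]
      split_ifs with h
      · rw [h, W_mul_neg hN, sub_self]
        congr 1
        simp [omega, dotProduct, ZMod.card]
      · rw [h2 _ (sub_ne_zero.2 (Ne.symm h)), zero_smul]
    rw [h1, Finset.sum_congr rfl fun u _ => h3 u, ← Finset.sum_filter, Finset.sum_const,
      ← Nat.cast_smul_eq_nsmul ℂ, smul_smul, mul_comm]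
  have hFpos : 0 < F.card := Finset.card_pos.2 ⟨0, by simp [hF]⟩
  set c : ℝ := (N : ℝ) ^ 4 * F.card with hc
  have hcpos : 0 < c := by
    have : 0 < (N : ℝ) := Nat.cast_pos.2 (Nat.pos_of_ne_zero (NeZero.ne N))
    have : 0 < (F.card : ℝ) := Nat.cast_pos.2 hFpos
    positivity
  have hcC : ((N : ℂ) ^ 4 * F.card) = (c : ℂ) := by rw [hc]; push_cast; rfl
  set s : ℂ := (((Real.sqrt c)⁻¹ : ℝ) : ℂ) with hs
  have hss : s * s * c = 1 := by
    rw [hs, ← Complex.ofReal_mul, ← Complex.ofReal_mul, ← mul_inv, Real.mul_self_sqrt hcpos.le,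
      inv_mul_cancel₀ hcpos.ne', Complex.ofReal_one]
  have hsc : conj s = s := Complex.conj_ofReal _
  have hUU : (s • U₀) * (s • U₁) = 1 := by
    rw [smul_mul_smul_comm, hprod, hcC, smul_smul, hss, one_smul]
  have hUU' : (s • U₁) * (s • U₀) = 1 := mul_eq_one_comm.1 hUU
  have hadj : ∀ φ ψ, hInner (U₀ φ) ψ = hInner φ (U₁ ψ) := by
    have key : ∀ (ι : Type) (t : Finset ι) (f : ι → State N) (ψ : State N),
        hInner (∑ i ∈ t, f i) ψ = ∑ i ∈ t, hInner (f i) ψ := by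
      intro ι t f ψ
      simp only [hInner, Finset.sum_apply, Finset.sum_mul, ← Finset.mul_sum]
      rw [Finset.sum_comm]
    have key' : ∀ (ι : Type) (t : Finset ι) (f : ι → State N) (ψ : State N),
        hInner ψ (∑ i ∈ t, f i) = ∑ i ∈ t, hInner ψ (f i) := by
      intro ι t f ψ
      simp only [hInner, Finset.sum_apply, map_sum, Finset.mul_sum]
      rw [Finset.sum_comm]
    intro φ ψ
    rw [hU₀, hU₁, LinearMap.sum_apply, LinearMap.sum_apply, key, key']
    refine Finset.sum_congr rfl fun u _ => ?_
    rw [Module.End.mul_apply, Module.End.mul_apply, hInner_W hN, hInner_W hN, neg_neg]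
  refine ⟨LinearEquiv.ofLinearMap (s • U₀) (s • U₁) hUU hUU', ?_, ?_⟩
  · intro φ ψ
    simp only [LinearEquiv.coe_ofLinearMap]
    have h4 : ∀ a b : State N, hInner (s • a) b = hInner a (s • b) := by
      intro a b
      simp only [hInner, Pi.smul_apply, smul_eq_mul, map_mul, hsc]
      congr 1
      exact Finset.sum_congr rfl fun y _ => by ring
    have h5 := LinearMap.congr_fun hUU' ψ
    simp only [Module.End.mul_apply, LinearMap.smul_apply, Module.End.one_apply, map_smul] at h5
    simp only [LinearMap.smul_apply]
    rw [h4, hadj, map_smul, map_smul, h5]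
  · intro n m hm hp φ
    rw [LinearEquiv.symm_apply_eq]
    simp only [LinearEquiv.coe_ofLinearMap]
    rw [T_eq_W hN, T_eq_W hN, sign_eq hp, hm]
    have := LinearMap.congr_fun (hint (redVec N n)) φ
    simp only [Module.End.mul_apply, LinearMap.smul_apply, map_smul] at this ⊢
    rw [this, smul_comm]

end Existence

/-- `C` is a Hecke group `C(N, A)`: a maximal commutative subgroup of `Sp(4, ℤ/N)` containing
the reduction of `A` modulo `N`. -/
def IsHeckeGroup (N : ℕ) (A : Sp4 ℤ) (C : Subgroup (Sp4 (ZMod N))) : Prop :=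
  Maximal (fun C : Subgroup (Sp4 (ZMod N)) =>
    (∀ g ∈ C, ∀ h ∈ C, g * h = h * g) ∧ redSp N A ∈ C) C

/-- `φ` is an eigenvector of all Hecke operators `U_N(B)`, `B ∈ C` (for every choice of phase). -/
def IsHeckeEigenfunction {N : ℕ} [NeZero N] (C : Subgroup (Sp4 (ZMod N))) (φ : State N) : Prop :=
  φ ≠ 0 ∧ ∀ B ∈ C, ∀ U, IsQuantization N B U → ∃ c : ℂ, U φ = c • φ

/-- A Hecke basis: an orthonormal basis of `H_N` consisting of Hecke eigenfunctions. -/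
def IsHeckeBasis {N : ℕ} [NeZero N] (C : Subgroup (Sp4 (ZMod N)))
    (φ : Module.Basis (Fin (N ^ 2)) ℂ (State N)) : Prop :=
  (∀ i j, hInner (φ i) (φ j) = if i = j then 1 else 0) ∧ ∀ j, IsHeckeEigenfunction C (φ j)

/-- The quantum variance
`S₂(f, N) = N⁻² ∑_j |⟨Op_N(f) φ_j, φ_j⟩ - ∫ f|²` in the basis `φ`. -/
noncomputable def S2 (f : UnitAddTorus (Fin 2 ⊕ Fin 2) → ℂ) (N : ℕ) [NeZero N]
    (φ : Module.Basis (Fin (N ^ 2)) ℂ (State N)) : ℝ :=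
  (1 / (N : ℝ) ^ 2) * ∑ j, ‖hInner (Op N f (φ j)) (φ j) - torusMean f‖ ^ 2

/-- The lattice `V ∩ ℤ⁴` of a subspace `V` of `ℚ⁴`. -/
def latticeOf (V : Submodule ℚ (Vec ℚ)) : Set (Vec ℤ) := {n | (fun i => (n i : ℚ)) ∈ V}

/-- `V` is a symplectic subspace of `ℚ⁴`: the restriction of `ω` to `V` is non-degenerate. -/
def IsSymplecticSubspace (V : Submodule ℚ (Vec ℚ)) : Prop :=
  ∀ v ∈ V, (∀ w ∈ V, omega v w = 0) → v = 0

/-- `V` is invariant under the action `v ↦ v A` on row vectors. -/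
def IsInvariantSubspace (A : Sp4 ℤ) (V : Submodule ℚ (Vec ℚ)) : Prop :=
  ∀ v ∈ V, v ᵥ* A.1.map (Int.cast : ℤ → ℚ) ∈ V

/-- `ℚ⁴ = V₁ ⊕ V₂` is a decomposition into two nonzero, mutually `ω`-orthogonal, symplectic,
`A`-invariant subspaces. -/
structure IsSymplecticDecomposition (A : Sp4 ℤ) (V₁ V₂ : Submodule ℚ (Vec ℚ)) : Prop where
  isCompl : IsCompl V₁ V₂
  ne_bot₁ : V₁ ≠ ⊥
  ne_bot₂ : V₂ ≠ ⊥
  orthogonal : ∀ v ∈ V₁, ∀ w ∈ V₂, omega v w = 0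
  symplectic₁ : IsSymplecticSubspace V₁
  symplectic₂ : IsSymplecticSubspace V₂
  invariant₁ : IsInvariantSubspace A V₁
  invariant₂ : IsInvariantSubspace A V₂

end CatMap

/-! For odd prime `N` the operator `T N n` is, up to sign, the Weyl operator `W v` with `v` the
reduction of `n`. For all but finitely many primes the rational decomposition reduces to two
orthogonal symplectic planes over `F = ZMod N`. On them `A` satisfies `x² - τᵢ x + 1 = 0` with `τ₁ ≠
τ₂`, so each plane is a copy of the quadratic algebra `F[√δᵢ]`, `δᵢ = τᵢ² - 4`. Pairs of norm-one
elements act by symplectic matrices that are polynomials in `A` and `A⁻¹`; maximality puts all of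
them in every Hecke group (`IsCyclicPair.exists_isHeckeFrame`).

By Egorov, the expectation of `W v` in a Hecke eigenfunction is constant on the orbit `O₁ × O₂` of
`v` under these pairs, so `W v` can be replaced by its orbit average `D`. A component of nonzero
norm has an orbit of `N - 1` to `N + 1` elements, a zero component an orbit of one. Weyl operators
are orthogonal for the Hilbert–Schmidt product, so `∑ ‖D φⱼ‖² = N² / (|O₁| |O₂|)`. Cauchy–Schwarz
gives the upper bound for the variance, with equality if every `φⱼ` is an eigenvector of `D`.

That is nearly true. A level set of the norm is detected by additive characters, so its Weyl sum is
a combination of Gaussian elements `gaussSum t`. For `t² δ ≠ 1` such an element is proportional on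
each eigenfunction to a Hecke operator, that of a Cayley transform (`gaussSum_mul`). For `t² δ = 1`,
which needs a split plane, it is `N² P Q` with `P`, `Q` the projections attached to the two null
lines. An eigenfunction is either killed by both or satisfies `(P - Q)² φ = (1 - 1/N) φ`
(`lineAvg_dichotomy`). The exceptional second kind carries at most `‖D (P - Q)‖² / (1 - 1/N)` of the
Hilbert–Schmidt norm, a fraction `O(1/N)` of the whole, because a nonzero level set meets each
translate of a null line at most once (`IsHeckeFrame.sum_exceptional_le`). Hence the variance is `(1
+ O(1/N)) / (|O₁| |O₂|)`. -/

namespace CatMap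

/-! ### Weyl relations on a plane: Gaussian elements and null lines -/

section WeylSystem

variable {N : ℕ} [Fact N.Prime]

/-- The norm form `x² - δ y²` on `F²`. -/
def nrm {F : Type*} [CommRing F] (δ : F) (z : F × F) : F := z.1 ^ 2 - δ * z.2 ^ 2

/-- The standard alternating form on `F²`. -/
def bracket {F : Type*} [CommRing F] (z z' : F × F) : F := z.2 * z'.1 - z.1 * z'.2

/-- The product in the quadratic algebra `F[√δ]`. -/
def quadMul {F : Type*} [CommRing F] (δ : F) (z g : F × F) : F × F :=
  (z.1 * g.1 + δ * (z.2 * g.2), z.1 * g.2 + z.2 * g.1)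

/-- Operators indexed by the plane `(ℤ/N)²` that satisfy the Weyl relations for the alternating
form `q · bracket`. -/
structure IsWeylSystem {𝒜 : Type*} [Ring 𝒜] [Algebra ℂ 𝒜] (q : ZMod N)
    (w : ZMod N × ZMod N → 𝒜) : Prop where
  zero : w 0 = 1
  mul : ∀ z z', w z * w z' = (ZMod.stdAddChar (2⁻¹ * (q * bracket z z')) : ℂ) • w (z + z')

variable {𝒜 : Type*} [Ring 𝒜] [Algebra ℂ 𝒜]

/-- The Gaussian element `∑_z ψ(t q nrm(z) / 4) w(z)`. -/
noncomputable def gaussSum (q δ : ZMod N) (w : ZMod N × ZMod N → 𝒜) (t : ZMod N) : 𝒜 :=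
  ∑ z, (ZMod.stdAddChar (t * (2⁻¹ * 2⁻¹ * q * nrm δ z)) : ℂ) • w z

/-- The average of `w` over the line spanned by `(1, t)`. -/
noncomputable def lineAvg (w : ZMod N × ZMod N → 𝒜) (t : ZMod N) : 𝒜 :=
  (N : ℂ)⁻¹ • ∑ a : ZMod N, w (a, a * t)

theorem sum_stdAddChar_mul (b : ZMod N) :
    ∑ x : ZMod N, (ZMod.stdAddChar (x * b) : ℂ) = if b = 0 then (N : ℂ) else 0 := by
  rw [AddChar.sum_mulShift b (ZMod.isPrimitive_stdAddChar N), ZMod.card]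
  split_ifs <;> simp

theorem natCast_prime_ne_zero : (N : ℂ) ≠ 0 := Nat.cast_ne_zero.2 (NeZero.ne N)

theorem nrm_eq_zero_iff {δ t : ZMod N} {z : ZMod N × ZMod N} (ht : t ^ 2 * δ = 1) :
    nrm δ z = 0 ↔ z.2 = z.1 * t ∨ z.2 = z.1 * -t := by
  have hδ : δ ≠ 0 := by rintro rfl; simp at ht
  have key : nrm δ z = -δ * ((z.2 - z.1 * t) * (z.2 - z.1 * -t)) := by
    simp only [nrm]; linear_combination -(z.1 ^ 2) * ht
  rw [key]
  simp [hδ, sub_eq_zero, add_eq_zero_iff_eq_neg]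

variable {q δ : ZMod N} {w : ZMod N × ZMod N → 𝒜}

/-- Fourier inversion in `t`: summing over `t` detects `nrm δ z = c`. The unit `q / 4` does not
affect the detection; it is there so that the Gaussian elements intertwine the Weyl operators. -/
theorem sum_nrm_eq (hq : q ≠ 0) (h2 : (2 : ZMod N) ≠ 0) (c : ZMod N) :
    (N : ℂ) • ∑ z with nrm δ z = c, w z =
      ∑ t : ZMod N, (ZMod.stdAddChar (t * -(2⁻¹ * 2⁻¹ * q * c)) : ℂ) • gaussSum q δ w t := by
  simp only [gaussSum, Finset.smul_sum, smul_smul, ← AddChar.map_add_eq_mul]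
  rw [Finset.sum_comm, Finset.sum_filter]
  refine Finset.sum_congr rfl fun z _ => ?_
  rw [← Finset.sum_smul]
  have : ∀ t : ZMod N, t * -(2⁻¹ * 2⁻¹ * q * c) + t * (2⁻¹ * 2⁻¹ * q * nrm δ z) =
      t * (2⁻¹ * 2⁻¹ * q * (nrm δ z - c)) := fun t => by ring
  simp only [this, sum_stdAddChar_mul]
  have h : 2⁻¹ * 2⁻¹ * q * (nrm δ z - c) = 0 ↔ nrm δ z = c := by
    simp [hq, h2, sub_eq_zero]
  simp only [h]
  split_ifs <;> simp

/-- The Gaussian element implements a norm-one multiplication. -/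
theorem gaussSum_mul (hw : IsWeylSystem q w) (h2 : (2 : ZMod N) ≠ 0) {t : ZMod N}
    (ht : t ^ 2 * δ ≠ 1) (z : ZMod N × ZMod N) :
    gaussSum q δ w t * w z =
      w (quadMul δ z (-(1 + t ^ 2 * δ) * (1 - t ^ 2 * δ)⁻¹, -2 * t * (1 - t ^ 2 * δ)⁻¹)) *
        gaussSum q δ w t := by
  have hm : (1 - t ^ 2 * δ) * (1 - t ^ 2 * δ)⁻¹ = 1 :=
    mul_inv_cancel₀ (sub_ne_zero.2 (Ne.symm ht))
  set m := (1 - t ^ 2 * δ)⁻¹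
  have hh : (2 : ZMod N) * 2⁻¹ = 1 := mul_inv_cancel₀ h2
  set h := (2 : ZMod N)⁻¹
  obtain ⟨x, y⟩ := z
  set z' := quadMul δ (x, y) (-(1 + t ^ 2 * δ) * m, -2 * t * m) with hz'
  -- After the shift of the summation variable by `z - z'` the phases on both sides agree for every
  -- `p` as soon as these two linear equations hold. Their solution is `z' = z g` with `g = -(1 +
  -- t√δ) / (1 - t√δ)`, an element of norm one.
  have e1 : x + z'.1 + t * δ * (y - z'.2) = 0 := by
    simp only [hz', quadMul]; linear_combination (-x - t * δ * y) * hm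
  have e2 : y + z'.2 + t * (x - z'.1) = 0 := by
    simp only [hz', quadMul]; linear_combination (-y - t * x) * hm
  clear_value z'
  obtain ⟨x', y'⟩ := z'
  simp only [gaussSum, Finset.sum_mul, Finset.mul_sum, smul_mul_assoc, mul_smul_comm, hw.mul,
    smul_smul, ← AddChar.map_add_eq_mul]
  refine Fintype.sum_equiv (Equiv.addRight ((x, y) - (x', y'))) _ _ fun p => ?_
  obtain ⟨a, b⟩ := p
  have hp : (a, b) + (x, y) = (x', y') + ((a, b) + ((x, y) - (x', y'))) := by abel
  rw [Equiv.coe_addRight, hp]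
  congr 2
  simp only [nrm, bracket, Prod.mk_add_mk, Prod.mk_sub_mk]
  linear_combination h ^ 2 * q * (2 * b + (y - y')) * e1 - h ^ 2 * q * (2 * a + (x - x')) * e2 -
    h * q * ((b * x - a * y) - (y' * (a + (x - x')) - x' * (b + (y - y')))) * hh

theorem line_mul_line (hw : IsWeylSystem q w) (t a b : ZMod N) :
    w (a, a * t) * w (b, b * t) = w (a + b, (a + b) * t) := by
  rw [hw.mul]
  have : bracket (a, a * t) (b, b * t) = 0 := by simp only [bracket]; ring
  rw [this]
  simp [add_mul]

/-- The line is isotropic, so `w` is a homomorphism on it and its average absorbs each of its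
elements; the average is therefore idempotent. -/
theorem line_mul_lineAvg (hw : IsWeylSystem q w) (t a : ZMod N) :
    w (a, a * t) * lineAvg w t = lineAvg w t := by
  rw [lineAvg, mul_smul_comm, Finset.mul_sum]
  congr 1
  exact Fintype.sum_equiv (Equiv.addLeft a) _ _ fun b => line_mul_line hw t a b

theorem lineAvg_mul_lineAvg (hw : IsWeylSystem q w) (t : ZMod N) :
    lineAvg w t * lineAvg w t = lineAvg w t := by
  have h : lineAvg w t * lineAvg w t =
      (N : ℂ)⁻¹ • ∑ a : ZMod N, w (a, a * t) * lineAvg w t := by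
    rw [← Finset.sum_mul, ← smul_mul_assoc]; rfl
  rw [h]
  simp only [line_mul_lineAvg hw, Finset.sum_const, Finset.card_univ, ZMod.card,
    ← Nat.cast_smul_eq_nsmul ℂ, smul_smul,
    inv_mul_cancel₀ (natCast_prime_ne_zero (N := N)), one_smul]

/-- In null coordinates `z = a (1, t) + b (1, -t)` the norm is `4ab`, and the Gaussian phase `t q a
b` is exactly the Weyl cocycle of `w (a, a t) * w (b, -b t)`. The sum therefore factors. -/
theorem gaussSum_eq_lineAvg_mul (hw : IsWeylSystem q w) (h2 : (2 : ZMod N) ≠ 0) {t : ZMod N}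
    (ht : t ^ 2 * δ = 1) :
    gaussSum q δ w t = ((N : ℂ) ^ 2) • (lineAvg w t * lineAvg w (-t)) := by
  have hh : (2 : ZMod N) * 2⁻¹ = 1 := mul_inv_cancel₀ h2
  have ht0 : t ≠ 0 := by rintro rfl; simp at ht
  have htt : t * t⁻¹ = 1 := mul_inv_cancel₀ ht0
  have hN := natCast_prime_ne_zero (N := N)
  simp only [lineAvg, smul_mul_smul_comm, smul_smul, Finset.sum_mul_sum]
  rw [show (N : ℂ) ^ 2 * ((N : ℂ)⁻¹ * (N : ℂ)⁻¹) = 1 by field_simp, one_smul,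
    ← Finset.sum_product', Finset.univ_product_univ, gaussSum]
  set h := (2 : ZMod N)⁻¹
  let E : ZMod N × ZMod N ≃ ZMod N × ZMod N :=
    { toFun := fun p => (h * (p.1 + t⁻¹ * p.2), h * (p.1 - t⁻¹ * p.2))
      invFun := fun p => (p.1 + p.2, t * (p.1 - p.2))
      left_inv := fun p => by
        ext
        · simp only; linear_combination p.1 * hh
        · simp only; linear_combination p.2 * t * t⁻¹ * hh + p.2 * htt
      right_inv := fun p => by
        ext
        · simp only; linear_combination p.1 * hh + h * (p.1 - p.2) * htt
        · simp only; linear_combination p.2 * hh - h * (p.1 - p.2) * htt }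
  refine Fintype.sum_equiv E _ _ fun p => ?_
  rw [hw.mul]
  obtain ⟨x, y⟩ := p
  simp only [E, Equiv.coe_fn_mk, Prod.mk_add_mk, bracket, nrm]
  congr 2
  · linear_combination
      -(h ^ 2 * q * t * y ^ 2 * t⁻¹ ^ 2) * ht +
      h ^ 2 * q * t * δ * y ^ 2 * (t * t⁻¹ + 1) * htt -
      h ^ 2 * q * t * (x ^ 2 - t⁻¹ ^ 2 * y ^ 2) * hh
  · ext
    · simp only; linear_combination -x * hh
    · simp only; linear_combination -(y * t * t⁻¹) * hh - y * htt

/-- The two null lines are not orthogonal: moving `w (b, -b t)` past the average over the first line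
twists that average by a character that is nontrivial for `b ≠ 0`. Only the term `b = 0` of the
second average survives, with weight `1/N`. -/
theorem lineAvg_mul_lineAvg_mul (hw : IsWeylSystem q w) (hq : q ≠ 0) (h2 : (2 : ZMod N) ≠ 0)
    {t : ZMod N} (ht : t ≠ 0) :
    lineAvg w t * lineAvg w (-t) * lineAvg w t = (N : ℂ)⁻¹ • lineAvg w t := by
  have hh : (2 : ZMod N) * 2⁻¹ = 1 := mul_inv_cancel₀ h2
  have key : ∀ b : ZMod N, lineAvg w t * w (b, b * -t) * lineAvg w t =
      if b = 0 then lineAvg w t else 0 := by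
    intro b
    have hc : ∀ a : ZMod N, w (a, a * t) * w (b, b * -t) =
        (ZMod.stdAddChar (a * (2 * t * q * b)) : ℂ) • (w (b, b * -t) * w (a, a * t)) := by
      intro a
      rw [hw.mul, hw.mul, smul_smul, ← AddChar.map_add_eq_mul, add_comm (b, b * -t)]
      congr 2
      simp only [bracket]
      linear_combination (2 * a * t * q * b) * hh
    have h : lineAvg w t * w (b, b * -t) * lineAvg w t =
        (N : ℂ)⁻¹ • ∑ a : ZMod N, w (a, a * t) * w (b, b * -t) * lineAvg w t := by
      rw [← Finset.sum_mul, ← Finset.sum_mul, ← smul_mul_assoc, ← smul_mul_assoc]; rfl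
    rw [h]
    simp only [hc, smul_mul_assoc, mul_assoc (w (b, b * -t)), line_mul_lineAvg hw]
    rw [← Finset.sum_smul, sum_stdAddChar_mul]
    by_cases hb : b = 0
    · subst hb
      have : w (0, 0) = 1 := hw.zero
      simp [this, smul_smul, inv_mul_cancel₀ (natCast_prime_ne_zero (N := N))]
    · simp [hb, ht, hq, h2]
  have h : lineAvg w t * lineAvg w (-t) * lineAvg w t =
      (N : ℂ)⁻¹ • ∑ b : ZMod N, lineAvg w t * w (b, b * -t) * lineAvg w t := by
    rw [← Finset.sum_mul, ← Finset.mul_sum, ← smul_mul_assoc, ← mul_smul_comm]; rfl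
  rw [h]
  simp only [key]
  simp

/-- The null cone is the union of two lines meeting only at `0`, where `w 0 = 1` would be counted
twice. -/
theorem sum_isotropic (hw : IsWeylSystem q w) (h2 : (2 : ZMod N) ≠ 0) {t : ZMod N}
    (ht : t ^ 2 * δ = 1) :
    ∑ z with nrm δ z = 0, w z = (N : ℂ) • (lineAvg w t + lineAvg w (-t)) - 1 := by
  have ht0 : t ≠ 0 := by rintro rfl; simp at ht
  have hN := natCast_prime_ne_zero (N := N)
  have hinj : ∀ s : ZMod N, Function.Injective fun a : ZMod N => (a, a * s) :=
    fun s a b hab => (Prod.ext_iff.1 hab).1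
  have hs : ∀ s : ZMod N, (N : ℂ) • lineAvg w s =
      ∑ z ∈ Finset.univ.map ⟨_, hinj s⟩, w z := by
    intro s
    rw [lineAvg, smul_smul, mul_inv_cancel₀ hN, one_smul, Finset.sum_map]; rfl
  have hU : (Finset.univ.filter fun z : ZMod N × ZMod N => nrm δ z = 0) =
      Finset.univ.map ⟨_, hinj t⟩ ∪ Finset.univ.map ⟨_, hinj (-t)⟩ := by
    ext ⟨x, y⟩
    simp [nrm_eq_zero_iff ht, eq_comm]
  have hI : Finset.univ.map ⟨_, hinj t⟩ ∩ Finset.univ.map ⟨_, hinj (-t)⟩ = {0} := by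
    ext ⟨x, y⟩
    simp only [Finset.mem_inter, Finset.mem_map, Finset.mem_univ, true_and,
      Function.Embedding.coeFn_mk, Prod.mk.injEq, Finset.mem_singleton, Prod.mk_eq_zero]
    constructor
    · rintro ⟨⟨a, rfl, rfl⟩, b, hb, h⟩
      subst hb
      have : 2 * (t * b) = 0 := by linear_combination -h
      simpa [h2, ht0] using this
    · rintro ⟨rfl, rfl⟩
      simp
  have := Finset.sum_union_inter (s₁ := Finset.univ.map ⟨_, hinj t⟩)
    (s₂ := Finset.univ.map ⟨_, hinj (-t)⟩) (f := w)
  rw [hI, Finset.sum_singleton, hw.zero, ← hU, ← hs, ← hs] at this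
  rw [smul_add, ← this, add_sub_cancel_right]

end WeylSystem

/-! ### Vectors on which the regular Gaussian elements act by scalars -/

section Vectors

variable {N : ℕ} [Fact N.Prime] {E : Type*} [AddCommGroup E] [Module ℂ E]
variable {q δ : ZMod N} {w : ZMod N × ZMod N → Module.End ℂ E}

/-- The singular Gaussian elements are products of line averages, hence kill `φ`; the regular ones
act by scalars. So does every combination of them. -/
theorem sum_nrm_apply (hw : IsWeylSystem q w) (hq : q ≠ 0) (h2 : (2 : ZMod N) ≠ 0) {φ : E}
    (hgood : ∀ t, t ^ 2 * δ ≠ 1 → ∃ c : ℂ, gaussSum q δ w t φ = c • φ)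
    (hline : ∀ t, t ^ 2 * δ = 1 → lineAvg w t φ = 0) (c : ZMod N) :
    ∃ s : ℂ, (∑ z with nrm δ z = c, w z) φ = s • φ := by
  have hN := natCast_prime_ne_zero (N := N)
  have h : ∀ t, ∃ s : ℂ, gaussSum q δ w t φ = s • φ := by
    intro t
    by_cases ht : t ^ 2 * δ = 1
    · refine ⟨0, ?_⟩
      rw [gaussSum_eq_lineAvg_mul hw h2 ht, LinearMap.smul_apply, Module.End.mul_apply,
        hline (-t) (by rwa [neg_sq]), map_zero, smul_zero, zero_smul]
    · exact hgood t ht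
  choose s hs using h
  refine ⟨(N : ℂ)⁻¹ * ∑ t : ZMod N,
    (ZMod.stdAddChar (t * -(2⁻¹ * 2⁻¹ * q * c)) : ℂ) * s t, ?_⟩
  have := congrArg (fun f : Module.End ℂ E => (N : ℂ)⁻¹ • f φ) (sum_nrm_eq (w := w) (δ := δ) hq h2 c)
  simp only [LinearMap.smul_apply, smul_smul, inv_mul_cancel₀ hN, one_smul] at this
  rw [this, LinearMap.sum_apply]
  simp only [LinearMap.smul_apply, hs, smul_smul, ← Finset.sum_smul]

/-- Up to scalars `(P - Q)²` is a combination of `1` and of the regular Gaussian elements, so `φ` is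
an eigenvector of it. The identities `P (P - Q)² = (1 - 1/N) P` and the same for `Q` fix the
eigenvalue unless `P φ = Q φ = 0`. -/
theorem lineAvg_dichotomy (hw : IsWeylSystem q w) (hq : q ≠ 0) (h2 : (2 : ZMod N) ≠ 0) {φ : E}
    (hgood : ∀ t, t ^ 2 * δ ≠ 1 → ∃ c : ℂ, gaussSum q δ w t φ = c • φ)
    {t : ZMod N} (ht : t ^ 2 * δ = 1) :
    (lineAvg w t φ = 0 ∧ lineAvg w (-t) φ = 0) ∨
      (lineAvg w t - lineAvg w (-t)) ((lineAvg w t - lineAvg w (-t)) φ) =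
        (1 - (N : ℂ)⁻¹) • φ := by
  have hN := natCast_prime_ne_zero (N := N)
  have ht0 : t ≠ 0 := by rintro rfl; simp at ht
  have hδ : δ ≠ 0 := by rintro rfl; simp at ht
  have ht' : (-t) ^ 2 * δ = 1 := by rwa [neg_sq]
  have hne : t ≠ -t := by
    intro h
    have : 2 * t = 0 := by linear_combination h
    simp [h2, ht0] at this
  set P := lineAvg w t
  set Q := lineAvg w (-t)
  have hPP : P * P = P := lineAvg_mul_lineAvg hw t
  have hQQ : Q * Q = Q := lineAvg_mul_lineAvg hw (-t)
  have hPQP : P * Q * P = (N : ℂ)⁻¹ • P := lineAvg_mul_lineAvg_mul hw hq h2 ht0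
  have hQPQ : Q * P * Q = (N : ℂ)⁻¹ • Q := by
    have := lineAvg_mul_lineAvg_mul hw hq h2 (neg_ne_zero.2 ht0)
    rwa [neg_neg] at this
  have hZ : (P - Q) * (P - Q) = P + Q - P * Q - Q * P := by
    rw [sub_mul, mul_sub, mul_sub, hPP, hQQ]; abel
  -- The Fourier formula at `c = 0` equates `N (N (P + Q) - 1)` with the regular Gaussian elements
  -- plus the two singular ones, `N² P Q` and `N² Q P`.
  have hsum : ((N : ℂ) ^ 2) • ((P - Q) * (P - Q)) =
      (N : ℂ) • 1 + ∑ s with s ^ 2 * δ ≠ 1, gaussSum q δ w s := by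
    have h0 := sum_nrm_eq (w := w) (δ := δ) hq h2 0
    simp only [mul_zero, neg_zero, AddChar.map_zero_eq_one, one_smul] at h0
    rw [sum_isotropic hw h2 ht, ← Finset.sum_filter_add_sum_filter_not Finset.univ
      (fun s => s ^ 2 * δ = 1)] at h0
    have hf : (Finset.univ.filter fun s : ZMod N => s ^ 2 * δ = 1) = {t, -t} := by
      ext s
      simp only [Finset.mem_filter, Finset.mem_univ, true_and, Finset.mem_insert,
        Finset.mem_singleton]
      rw [← sq_eq_sq_iff_eq_or_eq_neg]
      constructor
      · intro h; exact mul_right_cancel₀ hδ (h.trans ht.symm)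
      · intro h; rw [h, ht]
    rw [hf, Finset.sum_pair hne, gaussSum_eq_lineAvg_mul hw h2 ht,
      gaussSum_eq_lineAvg_mul hw h2 ht', neg_neg] at h0
    have h1 : ∑ s with ¬ s ^ 2 * δ = 1, gaussSum q δ w s = (N : ℂ) • ((N : ℂ) • (P + Q) - 1) -
        (((N : ℂ) ^ 2) • (P * Q) + ((N : ℂ) ^ 2) • (Q * P)) := by rw [h0]; abel
    simp only [ne_eq]
    rw [h1, hZ]
    module
  have hZe : ∃ c : ℂ, ((P - Q) * (P - Q)) φ = c • φ := by
    choose! c hc using hgood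
    refine ⟨((N : ℂ) ^ 2)⁻¹ * (N + ∑ s with s ^ 2 * δ ≠ 1, c s), ?_⟩
    have := congrArg (fun f : Module.End ℂ E => ((N : ℂ) ^ 2)⁻¹ • f φ) hsum
    simp only [LinearMap.smul_apply, smul_smul, inv_mul_cancel₀ (pow_ne_zero 2 hN), one_smul]
      at this
    rw [this, LinearMap.add_apply, LinearMap.sum_apply,
      Finset.sum_congr rfl fun s hs => hc s (Finset.mem_filter.1 hs).2, ← Finset.sum_smul,
      LinearMap.smul_apply, Module.End.one_apply, ← add_smul, smul_smul]
  obtain ⟨c, hc⟩ := hZe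
  have hPZ : P * ((P - Q) * (P - Q)) = (1 - (N : ℂ)⁻¹) • P := by
    rw [hZ, mul_sub, mul_sub, mul_add, ← mul_assoc, ← mul_assoc, hPP, hPQP]; module
  have hQZ : Q * ((P - Q) * (P - Q)) = (1 - (N : ℂ)⁻¹) • Q := by
    rw [hZ, mul_sub, mul_sub, mul_add, ← mul_assoc, ← mul_assoc, hQQ, hQPQ]; module
  have aux : ∀ X : Module.End ℂ E, X * ((P - Q) * (P - Q)) = (1 - (N : ℂ)⁻¹) • X →
      X φ ≠ 0 → c = 1 - (N : ℂ)⁻¹ := by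
    intro X hX hX0
    have := LinearMap.congr_fun hX φ
    rw [Module.End.mul_apply, hc, map_smul, LinearMap.smul_apply] at this
    exact smul_left_injective ℂ hX0 this
  by_cases h1 : P φ = 0
  · by_cases h3 : Q φ = 0
    · exact Or.inl ⟨h1, h3⟩
    · refine Or.inr ?_
      rw [← Module.End.mul_apply, hc, aux Q hQZ h3]
  · refine Or.inr ?_
    rw [← Module.End.mul_apply, hc, aux P hPZ h1]

end Vectors

/-! ### Inner products, traces and Hilbert–Schmidt norms -/

section StateSpace

variable {N : ℕ} [Fact N.Prime]

theorem hInner_sub_left (φ φ' ψ : State N) :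
    hInner (φ - φ') ψ = hInner φ ψ - hInner φ' ψ := by
  simp only [hInner, Pi.sub_apply, sub_mul, Finset.sum_sub_distrib, mul_sub]

theorem hInner_sub_right (φ ψ ψ' : State N) :
    hInner φ (ψ - ψ') = hInner φ ψ - hInner φ ψ' := by
  simp only [hInner, Pi.sub_apply, map_sub, mul_sub, Finset.sum_sub_distrib]

theorem hInner_smul_left (c : ℂ) (φ ψ : State N) : hInner (c • φ) ψ = c * hInner φ ψ := by
  simp only [hInner, Pi.smul_apply, smul_eq_mul, mul_assoc, ← Finset.mul_sum]
  ring

theorem hInner_smul_right (c : ℂ) (φ ψ : State N) : hInner φ (c • ψ) = conj c * hInner φ ψ := by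
  simp only [hInner, Pi.smul_apply, smul_eq_mul, map_mul, mul_left_comm _ (conj c),
    ← Finset.mul_sum]

theorem hInner_sum_left {ι : Type*} (s : Finset ι) (f : ι → State N) (ψ : State N) :
    hInner (∑ i ∈ s, f i) ψ = ∑ i ∈ s, hInner (f i) ψ := by
  simp only [hInner, Finset.sum_apply, Finset.sum_mul, ← Finset.mul_sum]
  rw [Finset.sum_comm]

theorem hInner_sum_right {ι : Type*} (s : Finset ι) (f : ι → State N) (ψ : State N) :
    hInner ψ (∑ i ∈ s, f i) = ∑ i ∈ s, hInner ψ (f i) := by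
  simp only [hInner, Finset.sum_apply, map_sum, Finset.mul_sum]
  rw [Finset.sum_comm]

/-- The squared norm of a state. -/
noncomputable def stateNormSq (φ : State N) : ℝ := (1 / (N : ℝ) ^ 2) * ∑ y, ‖φ y‖ ^ 2

theorem stateNormSq_nonneg (φ : State N) : 0 ≤ stateNormSq φ :=
  mul_nonneg (by positivity) (Finset.sum_nonneg fun _ _ => by positivity)

theorem hInner_self (φ : State N) : hInner φ φ = (stateNormSq φ : ℂ) := by
  simp only [hInner, stateNormSq, Complex.mul_conj, Complex.normSq_eq_norm_sq]
  push_cast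
  rfl

theorem stateNormSq_smul (c : ℂ) (φ : State N) :
    stateNormSq (c • φ) = ‖c‖ ^ 2 * stateNormSq φ := by
  simp only [stateNormSq, Pi.smul_apply, smul_eq_mul, norm_mul, mul_pow, ← Finset.mul_sum]
  ring

theorem stateNormSq_sub_le (φ ψ : State N) :
    stateNormSq (φ - ψ) ≤ 2 * stateNormSq φ + 2 * stateNormSq ψ := by
  have : ∑ y, ‖(φ - ψ) y‖ ^ 2 ≤ 2 * ∑ y, ‖φ y‖ ^ 2 + 2 * ∑ y, ‖ψ y‖ ^ 2 := by
    rw [Finset.mul_sum, Finset.mul_sum, ← Finset.sum_add_distrib]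
    refine Finset.sum_le_sum fun y _ => ?_
    have h := norm_sub_le (φ y) (ψ y)
    have h0 := norm_nonneg (φ y - ψ y)
    simp only [Pi.sub_apply]
    nlinarith [sq_nonneg (‖φ y‖ - ‖ψ y‖)]
  simp only [stateNormSq]
  have h2 : (0 : ℝ) ≤ 1 / (N : ℝ) ^ 2 := by positivity
  nlinarith [mul_le_mul_of_nonneg_left this h2]

theorem norm_hInner_sq_le (φ ψ : State N) :
    ‖hInner φ ψ‖ ^ 2 ≤ stateNormSq φ * stateNormSq ψ := by
  have h1 : ‖∑ y, φ y * conj (ψ y)‖ ≤ ∑ y, ‖φ y‖ * ‖ψ y‖ :=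
    (norm_sum_le _ _).trans (le_of_eq (by simp))
  have h2 := Finset.sum_mul_sq_le_sq_mul_sq Finset.univ (fun y => ‖φ y‖) (fun y => ‖ψ y‖)
  have h3 : ‖∑ y, φ y * conj (ψ y)‖ ^ 2 ≤ (∑ y, ‖φ y‖ ^ 2) * ∑ y, ‖ψ y‖ ^ 2 :=
    (pow_le_pow_left₀ (norm_nonneg _) h1 2).trans h2
  rw [hInner, norm_mul, mul_pow, stateNormSq, stateNormSq]
  have h4 : ‖(1 / (N : ℂ) ^ 2)‖ = 1 / (N : ℝ) ^ 2 := by simp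
  rw [h4]
  calc (1 / (N : ℝ) ^ 2) ^ 2 * ‖∑ y, φ y * conj (ψ y)‖ ^ 2
      ≤ (1 / (N : ℝ) ^ 2) ^ 2 * ((∑ y, ‖φ y‖ ^ 2) * ∑ y, ‖ψ y‖ ^ 2) := by gcongr
    _ = _ := by ring

/-- The trace is computed in any orthonormal basis. -/
theorem sum_hInner_eq_trace {ι : Type*} [Fintype ι] [DecidableEq ι]
    (φ : Module.Basis ι ℂ (State N))
    (hφ : ∀ i j, hInner (φ i) (φ j) = if i = j then 1 else 0) (Y : Module.End ℂ (State N)) :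
    ∑ j, hInner (Y (φ j)) (φ j) = LinearMap.trace ℂ (State N) Y := by
  have hrepr : ∀ ψ j, hInner ψ (φ j) = φ.repr ψ j := by
    intro ψ j
    conv_lhs => rw [← φ.sum_repr ψ]
    rw [hInner_sum_left]
    simp [hInner_smul_left, hφ]
  rw [LinearMap.trace_eq_matrix_trace ℂ φ, Matrix.trace]
  refine Finset.sum_congr rfl fun j _ => ?_
  rw [hrepr, Matrix.diag_apply, LinearMap.toMatrix_apply]

theorem odd_of_two_ne_zero (h2 : (2 : ZMod N) ≠ 0) : Odd N := by
  refine (Fact.out : N.Prime).odd_of_ne_two ?_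
  intro h
  subst h
  exact h2 (by rfl)

theorem exists_omega_ne_zero {v : Vec (ZMod N)} (hv : v ≠ 0) : ∃ u, omega u v ≠ 0 := by
  by_contra! h
  refine hv (funext fun i => ?_)
  rcases i with i | i
  · have := h (Pi.single (Sum.inr i) 1)
    fin_cases i <;> simpa [omega, dotProduct, Pi.single_apply] using this
  · have := h (Pi.single (Sum.inl i) 1)
    fin_cases i <;> simpa [omega, dotProduct, Pi.single_apply] using this

/-- For `v ≠ 0` some `W u` conjugates `W v` to a multiple of itself by a scalar other than `1`,
which forces trace zero. -/
theorem trace_W (h2 : (2 : ZMod N) ≠ 0) (v : Vec (ZMod N)) :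
    LinearMap.trace ℂ (State N) (W v) = if v = 0 then (N : ℂ) ^ 2 else 0 := by
  have hN := odd_of_two_ne_zero h2
  split_ifs with hv
  · subst hv
    rw [W_zero, LinearMap.trace_one]
    simp [ZMod.card]
  · obtain ⟨u, hu⟩ := exists_omega_ne_zero hv
    have h1 := congrArg (fun X => LinearMap.trace ℂ (State N) (W (-u) * X)) (W_conj hN u v)
    have h3 : W (-u) * W u = 1 := by simpa using W_mul_neg hN (-u)
    simp only [mul_smul_comm, map_smul] at h1
    rw [← mul_assoc, h3, one_mul, LinearMap.trace_mul_comm, mul_assoc, W_mul_neg hN, mul_one,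
      smul_eq_mul] at h1
    have h4 : (ZMod.stdAddChar (omega u v) : ℂ) ≠ 1 := fun h =>
      hu (ZMod.injective_stdAddChar (h.trans (AddChar.map_zero_eq_one _).symm))
    by_contra h0
    exact h4 (mul_right_cancel₀ h0 (by rw [one_mul]; exact h1.symm))

/-- Parseval for the Hilbert–Schmidt norm: distinct Weyl operators are orthogonal, each of squared
norm `N²`. Injectivity of `f` prevents coefficients from merging. -/
theorem sum_stateNormSq_eq {ι : Type*} [Fintype ι] [DecidableEq ι]
    (φ : Module.Basis ι ℂ (State N))
    (hφ : ∀ i j, hInner (φ i) (φ j) = if i = j then 1 else 0) (h2 : (2 : ZMod N) ≠ 0)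
    {κ : Type*} (s : Finset κ) (c : κ → ℂ) (f : κ → Vec (ZMod N)) (hf : Set.InjOn f s) :
    ∑ j, stateNormSq ((∑ i ∈ s, c i • W (f i)) (φ j)) = (N : ℝ) ^ 2 * ∑ i ∈ s, ‖c i‖ ^ 2 := by
  classical
  have hN := odd_of_two_ne_zero h2
  have key : ∀ i ∈ s, ∀ k ∈ s, ∑ j, hInner (W (f i) (φ j)) (W (f k) (φ j)) =
      if i = k then (N : ℂ) ^ 2 else 0 := by
    intro i hi k hk
    have : ∀ j, hInner (W (f i) (φ j)) (W (f k) (φ j)) =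
        hInner ((W (-f k) * W (f i)) (φ j)) (φ j) := by
      intro j
      rw [Module.End.mul_apply, hInner_W hN (-f k), neg_neg]
    simp only [this]
    rw [sum_hInner_eq_trace φ hφ, W_mul hN, map_smul, trace_W h2]
    have hik : -f k + f i = 0 ↔ i = k := by
      rw [neg_add_eq_zero]
      exact ⟨fun h => hf hi hk h.symm, fun h => by rw [h]⟩
    simp only [hik]
    split_ifs with h
    · subst h
      simp [omega_neg_left, omega_self]
    · simp
  have hC : ((∑ j, stateNormSq ((∑ i ∈ s, c i • W (f i)) (φ j)) : ℝ) : ℂ) =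
      (((N : ℝ) ^ 2 * ∑ i ∈ s, ‖c i‖ ^ 2 : ℝ) : ℂ) := by
    simp only [LinearMap.sum_apply, LinearMap.smul_apply]
    push_cast
    simp only [← hInner_self, hInner_sum_left, hInner_sum_right, hInner_smul_left,
      hInner_smul_right]
    rw [Finset.sum_comm, Finset.mul_sum]
    refine Finset.sum_congr rfl fun i hi => ?_
    simp only [← Finset.mul_sum]
    rw [Finset.sum_comm]
    have : ∀ k ∈ s, ∑ j, c k * hInner (W (f k) (φ j)) (W (f i) (φ j)) =
        if k = i then c i * (N : ℂ) ^ 2 else 0 := by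
      intro k hk
      rw [← Finset.mul_sum, key k hk i hi]
      split_ifs with h
      · rw [h]
      · simp
    rw [Finset.sum_congr rfl this, Finset.sum_ite_eq', if_pos hi, ← mul_assoc, mul_comm (conj _),
      Complex.mul_conj, Complex.normSq_eq_norm_sq]
    push_cast
    ring
  exact_mod_cast hC

/-- Cyclicity of the trace, for the Hilbert–Schmidt norm of `X M` with `M` self-adjoint. -/
theorem sum_hInner_mul_sq {ι : Type*} [Fintype ι] [DecidableEq ι]
    (φ : Module.Basis ι ℂ (State N))
    (hφ : ∀ i j, hInner (φ i) (φ j) = if i = j then 1 else 0)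
    {X Y M : Module.End ℂ (State N)} (hXY : ∀ a b, hInner (Y a) b = hInner a (X b))
    (hM : ∀ a b, hInner (M a) b = hInner a (M b)) :
    ∑ j, hInner (X (M (M (φ j)))) (X (φ j)) = ∑ j, (stateNormSq (X (M (φ j))) : ℂ) := by
  have h1 : ∀ j, hInner (X (M (M (φ j)))) (X (φ j)) = hInner ((Y * X * M * M) (φ j)) (φ j) :=
    fun j => (hXY _ _).symm
  have h2 : ∀ j, (stateNormSq (X (M (φ j))) : ℂ) = hInner ((M * (Y * X * M)) (φ j)) (φ j) := by
    intro j
    rw [← hInner_self]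
    simp only [Module.End.mul_apply]
    rw [hM, hXY]
  simp only [h1, h2, sum_hInner_eq_trace φ hφ]
  exact LinearMap.trace_mul_comm ℂ _ _

end StateSpace

/-! ### Hecke operators and their eigenfunctions -/

section Hecke

variable {N : ℕ} [Fact N.Prime]

/-- The Egorov identity for the operators indexed by vectors modulo `N`. -/
theorem IsQuantization.W_apply (h2 : (2 : ZMod N) ≠ 0) {B : Sp4 (ZMod N)}
    {U : State N ≃ₗ[ℂ] State N} (hU : IsQuantization N B U) (v : Vec (ZMod N)) (φ : State N) :
    W v (U φ) = U (W (v ᵥ* B.1) φ) := by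
  have hN := odd_of_two_ne_zero h2
  -- Since `N` is odd, `1 + N` is even and congruent to `1` modulo `N`. These lifts are thus even
  -- vectors: the sign relating `T` to `W` is `1` and the parity condition of `IsQuantization`
  -- holds.
  let lift : Vec (ZMod N) → Vec ℤ := fun v i => (1 + N : ℤ) * ((v i).val : ℤ)
  have hl : ∀ v, redVec N (lift v) = v := fun v => by
    funext i; simp [redVec, lift]
  have hl2 : ∀ v, redVec 2 (lift v) = redVec 2 0 := fun v => by
    funext i
    obtain ⟨r, hr⟩ := hN
    have : (1 + (N : ℤ)) = 2 * (r + 1) := by rw [hr]; push_cast; ring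
    have h20 : (2 : ZMod 2) = 0 := by decide
    simp [redVec, lift, this, h20]
  have hT : ∀ v, T N (lift v) = W v := fun v => by
    rw [T_eq_W hN, hl, sign_eq (hl2 v).symm]
    simp
  have := hU.2 (lift v) (lift (v ᵥ* B.1)) (by rw [hl, hl]) ((hl2 _).trans (hl2 _).symm) φ
  rw [hT, hT, LinearEquiv.symm_apply_eq] at this
  exact this

theorem stateNormSq_pos {φ : State N} (hφ : φ ≠ 0) : 0 < stateNormSq φ := by
  obtain ⟨y, hy⟩ := Function.ne_iff.1 hφ
  have hN : 0 < (N : ℝ) := Nat.cast_pos.2 (Fact.out : N.Prime).pos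
  refine mul_pos (by positivity) ?_
  exact Finset.sum_pos' (fun _ _ => by positivity)
    ⟨y, Finset.mem_univ _, pow_pos (norm_pos_iff.2 hy) 2⟩

/-- Conjugating by the unitary `U_N(B)` turns `W (v B)` into `W v`, and the eigenvalue of `φ`
cancels because it has modulus one. -/
theorem IsHeckeEigenfunction.hInner_W {C : Subgroup (Sp4 (ZMod N))} {φ : State N}
    (hφ : IsHeckeEigenfunction C φ) (h2 : (2 : ZMod N) ≠ 0) {B : Sp4 (ZMod N)} (hB : B ∈ C)
    (v : Vec (ZMod N)) : hInner (W (v ᵥ* B.1) φ) φ = hInner (W v φ) φ := by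
  obtain ⟨U, hU⟩ := exists_isQuantization (odd_of_two_ne_zero h2) B
  obtain ⟨c, hc⟩ := hφ.2 B hB U hU
  have hc1 : c * conj c = 1 := by
    have h := hU.1 φ φ
    rw [hc, hInner_smul_left, hInner_smul_right, ← mul_assoc, hInner_self] at h
    have h0 : (stateNormSq φ : ℂ) ≠ 0 := by exact_mod_cast (stateNormSq_pos hφ.1).ne'
    exact mul_right_cancel₀ h0 (by rw [one_mul]; exact h)
  rw [← hU.1 (W (v ᵥ* B.1) φ) φ, ← hU.W_apply h2, hc, map_smul, hInner_smul_left,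
    hInner_smul_right, ← mul_assoc, hc1, one_mul]

/-- The Weyl operators act irreducibly. -/
theorem exists_scalar_of_commute {X : Module.End ℂ (State N)}
    (hX : ∀ v, W v * X = X * W v) : ∃ s : ℂ, ∀ φ, X φ = s • φ := by
  have hX' : ∀ v φ, W v (X φ) = X (W v φ) := fun v φ => LinearMap.congr_fun (hX v) φ
  set d : State N := Pi.single 0 1
  -- The delta function at `0` is, up to scalars, the only vector fixed by all multiplications by
  -- characters, so `X` preserves its line. Translations then carry the scalar to every other delta
  -- function.
  have h0 : X d = X d 0 • d := by
    funext y
    by_cases hy : y = 0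
    · subst hy; simp [d]
    · obtain ⟨i, hi⟩ := Function.ne_iff.1 hy
      let v : Vec (ZMod N) := Sum.elim 0 (Pi.single i 1)
      have hv : ∀ (ψ : State N) (z : Fin 2 → ZMod N),
          W v ψ z = ZMod.stdAddChar (z i) * ψ z := by
        intro ψ z
        rw [CatMap.W_apply]
        have e1 : v ∘ Sum.inr = Pi.single i 1 := rfl
        have e2 : v ∘ Sum.inl = 0 := rfl
        rw [e1, e2]
        simp
      have hd : W v d = d := by
        funext z
        rw [hv]
        by_cases hz : z = 0
        · subst hz; simp
        · simp [d, hz]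
      have h1 := congrFun (hX' v d) y
      rw [hd, hv] at h1
      have h4 : (ZMod.stdAddChar (y i) : ℂ) ≠ 1 := fun h =>
        hi (ZMod.injective_stdAddChar (h.trans (AddChar.map_zero_eq_one _).symm))
      have : X d y = 0 := by
        by_contra h
        exact h4 (mul_right_cancel₀ h (by rw [h1, one_mul]))
      simp [this, d, hy]
  refine ⟨X d 0, fun φ => ?_⟩
  suffices X = X d 0 • LinearMap.id by
    conv_lhs => rw [this]
    rfl
  refine LinearMap.pi_ext fun a x => ?_
  let v : Vec (ZMod N) := Sum.elim (-a) 0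
  have hd : (Pi.single a x : State N) = x • W v d := by
    funext y
    simp only [Pi.smul_apply, CatMap.W_apply, smul_eq_mul]
    have e1 : v ∘ Sum.inr = 0 := rfl
    have e2 : v ∘ Sum.inl = -a := rfl
    rw [e1, e2]
    simp only [dotProduct_zero, mul_zero, zero_dotProduct, add_zero, AddChar.map_zero_eq_one,
      one_mul, d, Pi.single_apply, add_neg_eq_zero]
    split_ifs <;> simp
  have h1 : X (W v d) = X d 0 • W v d := by rw [← hX', ← map_smul, ← h0]
  rw [hd, map_smul, h1, LinearMap.smul_apply, LinearMap.id_apply, smul_comm]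

/-- An operator that intertwines the Weyl operators as `U_N(B)` does, acts on a Hecke
eigenfunction by a scalar. -/
theorem IsHeckeEigenfunction.exists_eigenvalue {C : Subgroup (Sp4 (ZMod N))} {φ : State N}
    (hφ : IsHeckeEigenfunction C φ) (h2 : (2 : ZMod N) ≠ 0) {B : Sp4 (ZMod N)} (hB : B ∈ C)
    {R : Module.End ℂ (State N)} (hR : ∀ v, W v * R = R * W (v ᵥ* B.1)) :
    ∃ c : ℂ, R φ = c • φ := by
  obtain ⟨U, hU⟩ := exists_isQuantization (odd_of_two_ne_zero h2) B
  obtain ⟨c, hc⟩ := hφ.2 B hB U hU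
  have hdet : IsUnit B.1.det := SymplecticGroup.symplectic_det B.2
  -- `R` and `U` intertwine the Weyl operators in the same way, so `U⁻¹ R` commutes with all of them
  -- and is a scalar by Schur's lemma. No invertibility of `R` is needed.
  obtain ⟨s, hs⟩ := exists_scalar_of_commute
    (X := (U.symm : State N →ₗ[ℂ] State N) ∘ₗ R) (fun v => by
      refine LinearMap.ext fun ψ => ?_
      have hv : v = (v ᵥ* (B⁻¹).1) ᵥ* B.1 := by
        rw [Matrix.vecMul_vecMul]
        have : (B⁻¹).1 * B.1 = 1 := congrArg Subtype.val (inv_mul_cancel B)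
        rw [this, Matrix.vecMul_one]
      have h1 := LinearMap.congr_fun (hR (v ᵥ* (B⁻¹).1)) ψ
      rw [← hv] at h1
      have h3 := hU.W_apply h2 (v ᵥ* (B⁻¹).1) (U.symm (R ψ))
      rw [← hv, U.apply_symm_apply] at h3
      simp only [Module.End.mul_apply, LinearMap.comp_apply, LinearEquiv.coe_coe] at h1 ⊢
      rw [← h1, h3, U.symm_apply_apply])
  refine ⟨s * c, ?_⟩
  have := hs φ
  simp only [LinearMap.comp_apply, LinearEquiv.coe_coe] at this
  rw [U.symm_apply_eq, map_smul, hc, smul_smul] at this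
  exact this

end Hecke

/-! ### Two orthogonal planes: orbit averages and exceptional eigenfunctions -/

section Frame

variable {N : ℕ} [Fact N.Prime]

/-- Coordinates on `(ℤ/N)⁴` adapted to a splitting into two symplectic planes, in which the group
`C` contains all pairs of norm-one elements of the quadratic algebras `F[√δ₁]`, `F[√δ₂]`. -/
structure IsHeckeFrame (C : Subgroup (Sp4 (ZMod N))) (δ₁ δ₂ q₁ q₂ : ZMod N)
    (e : (ZMod N × ZMod N) × (ZMod N × ZMod N) ≃+ Vec (ZMod N)) : Prop where
  omega_eq : ∀ z z', omega (e z) (e z') = q₁ * bracket z.1 z'.1 + q₂ * bracket z.2 z'.2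
  exists_mem : ∀ g₁ g₂, nrm δ₁ g₁ = 1 → nrm δ₂ g₂ = 1 →
    ∃ B ∈ C, ∀ z, e z ᵥ* B.1 = e (quadMul δ₁ z.1 g₁, quadMul δ₂ z.2 g₂)

variable {C : Subgroup (Sp4 (ZMod N))} {δ₁ δ₂ q₁ q₂ : ZMod N}
  {e : (ZMod N × ZMod N) × (ZMod N × ZMod N) ≃+ Vec (ZMod N)}

theorem bracket_zero_left {F : Type*} [CommRing F] (z : F × F) : bracket 0 z = 0 := by
  simp [bracket]

theorem bracket_zero_right {F : Type*} [CommRing F] (z : F × F) : bracket z 0 = 0 := by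
  simp [bracket]

theorem quadMul_one {F : Type*} [CommRing F] (δ : F) (z : F × F) : quadMul δ z (1, 0) = z := by
  simp [quadMul]

/-- Lets statements proved for the first plane be applied to the second. -/
theorem IsHeckeFrame.swap (he : IsHeckeFrame C δ₁ δ₂ q₁ q₂ e) :
    IsHeckeFrame C δ₂ δ₁ q₂ q₁ (AddEquiv.prodComm.trans e) where
  omega_eq z z' := by
    have := he.omega_eq z.swap z'.swap
    rw [add_comm] at this
    exact this
  exists_mem g₁ g₂ h₁ h₂ := by
    obtain ⟨B, hB, h⟩ := he.exists_mem g₂ g₁ h₂ h₁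
    exact ⟨B, hB, fun z => h z.swap⟩

theorem IsHeckeFrame.isWeylSystem (he : IsHeckeFrame C δ₁ δ₂ q₁ q₂ e)
    (h2 : (2 : ZMod N) ≠ 0) : IsWeylSystem q₁ fun z => W (e (z, 0)) where
  zero := by
    have : e ((0 : ZMod N × ZMod N), (0 : ZMod N × ZMod N)) = 0 := e.map_zero
    rw [this, W_zero]
  mul z z' := by
    rw [W_mul (odd_of_two_ne_zero h2), he.omega_eq, ← map_add, bracket_zero_left, mul_zero,
      add_zero, Prod.mk_add_mk, add_zero]

theorem IsHeckeFrame.W_eq_mul (he : IsHeckeFrame C δ₁ δ₂ q₁ q₂ e) (h2 : (2 : ZMod N) ≠ 0)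
    (z : (ZMod N × ZMod N) × (ZMod N × ZMod N)) :
    W (e z) = W (e (z.1, 0)) * W (e (0, z.2)) := by
  rw [W_mul (odd_of_two_ne_zero h2), he.omega_eq, ← map_add]
  simp [bracket_zero_left, bracket_zero_right]

theorem IsHeckeFrame.W_comm (he : IsHeckeFrame C δ₁ δ₂ q₁ q₂ e) (h2 : (2 : ZMod N) ≠ 0)
    (z z' : ZMod N × ZMod N) :
    W (e (z, 0)) * W (e (0, z')) = W (e (0, z')) * W (e (z, 0)) := by
  rw [W_conj (odd_of_two_ne_zero h2), he.omega_eq]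
  simp [bracket_zero_left, bracket_zero_right]

/-- The Gaussian element of the first plane commutes with the Weyl operators of the second, so it
intertwines as the quantization of a pair (Cayley transform, `1`), which belongs to `C`. -/
theorem IsHeckeFrame.exists_gaussSum_eigenvalue (he : IsHeckeFrame C δ₁ δ₂ q₁ q₂ e)
    (h2 : (2 : ZMod N) ≠ 0) {φ : State N} (hφ : IsHeckeEigenfunction C φ) (t : ZMod N)
    (ht : t ^ 2 * δ₁ ≠ 1) : ∃ c : ℂ, gaussSum q₁ δ₁ (fun z => W (e (z, 0))) t φ = c • φ := by
  have hm : (1 - t ^ 2 * δ₁) * (1 - t ^ 2 * δ₁)⁻¹ = 1 :=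
    mul_inv_cancel₀ (sub_ne_zero.2 (Ne.symm ht))
  have hg := fun z => gaussSum_mul (he.isWeylSystem h2) h2 ht z
  set m := (1 - t ^ 2 * δ₁)⁻¹
  set R := gaussSum q₁ δ₁ (fun z => W (e (z, 0))) t with hRdef
  set α := -(1 + t ^ 2 * δ₁) * m with hα
  set β := -2 * t * m with hβ
  have hn : α ^ 2 - δ₁ * β ^ 2 = 1 := by
    rw [hα, hβ]; linear_combination ((1 - t ^ 2 * δ₁) * m + 1) * hm
  -- `gaussSum_mul` gives `R W(z) = W(z g) R`, whereas the intertwining relation wanted is `W(z) R =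
  -- R W(z B)`. Hence `B` is multiplication by the inverse of `g = (α, β)`, which is its conjugate.
  obtain ⟨B, hB, hact⟩ := he.exists_mem (α, -β) (1, 0)
    (by simp only [nrm]; linear_combination hn) (by simp [nrm])
  refine hφ.exists_eigenvalue h2 hB fun v => ?_
  obtain ⟨z, rfl⟩ := e.surjective v
  have hR : R * W (e (0, z.2)) = W (e (0, z.2)) * R := by
    simp only [hRdef, gaussSum, Finset.sum_mul, Finset.mul_sum, smul_mul_assoc, mul_smul_comm,
      he.W_comm h2]
  have hz : quadMul δ₁ (quadMul δ₁ z.1 (α, -β)) (α, β) = z.1 := by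
    ext
    · simp only [quadMul]; linear_combination z.1.1 * hn
    · simp only [quadMul]; linear_combination z.1.2 * hn
  rw [hact, he.W_eq_mul h2 z, he.W_eq_mul h2 (quadMul _ _ _, _), ← mul_assoc, hg, hz, quadMul_one, mul_assoc,
    mul_assoc, hR]

/-- The level sets `{nrm = c}`, `c ≠ 0`, and `{0}`: orbits of the norm-one group. -/
def IsNormOrbit (δ : ZMod N) (O : Finset (ZMod N × ZMod N)) : Prop :=
  O = {0} ∨ ∃ c, c ≠ 0 ∧ O = Finset.univ.filter fun z => nrm δ z = c

theorem IsNormOrbit.exists_quadMul {δ : ZMod N} {O : Finset (ZMod N × ZMod N)}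
    (hO : IsNormOrbit δ O) {z z' : ZMod N × ZMod N} (hz : z ∈ O) (hz' : z' ∈ O) :
    ∃ g, nrm δ g = 1 ∧ quadMul δ z g = z' := by
  rcases hO with rfl | ⟨c, hc, rfl⟩
  · rw [Finset.mem_singleton] at hz hz'
    subst hz hz'
    exact ⟨(1, 0), by simp [nrm], quadMul_one _ _⟩
  · obtain ⟨x, y⟩ := z
    obtain ⟨x', y'⟩ := z'
    rw [Finset.mem_filter] at hz hz'
    simp only [Finset.mem_univ, true_and, nrm] at hz hz'
    have hcc : c * c⁻¹ = 1 := mul_inv_cancel₀ hc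
    -- The quotient `z' / z`, computed as `z'` times the conjugate of `z` divided by the norm `c`.
    refine ⟨((x' * x - δ * (y' * y)) * c⁻¹, (y' * x - x' * y) * c⁻¹), ?_, ?_⟩
    · simp only [nrm]
      linear_combination c⁻¹ ^ 2 * (x' ^ 2 - δ * y' ^ 2) * hz + c⁻¹ ^ 2 * c * hz' +
        (c * c⁻¹ + 1) * hcc
    · ext
      · simp only [quadMul]; linear_combination x' * c⁻¹ * hz + x' * hcc
      · simp only [quadMul]; linear_combination y' * c⁻¹ * hz + y' * hcc

/-- Along a null line the norm is affine, `nrm (z + a (1, t)) = nrm z + 2 a (x - δ t y)`. Two points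
of one level set on such a line force the slope to vanish, and then `nrm z = 0`. This keeps the
terms of `D P` distinct. -/
theorem IsNormOrbit.line_inj {δ t : ZMod N} (h2 : (2 : ZMod N) ≠ 0) (ht : t ^ 2 * δ = 1)
    {O : Finset (ZMod N × ZMod N)} (hO : IsNormOrbit δ O) {z z' : ZMod N × ZMod N} (hz : z ∈ O)
    (hz' : z' ∈ O) {a a' : ZMod N} (h : z + (a, a * t) = z' + (a', a' * t)) :
    z = z' ∧ a = a' := by
  suffices a = a' by subst this; exact ⟨add_right_cancel h, rfl⟩
  obtain ⟨x, y⟩ := z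
  obtain ⟨x', y'⟩ := z'
  obtain ⟨h1, h3⟩ := Prod.ext_iff.1 h
  simp only [Prod.mk_add_mk] at h1 h3
  rcases hO with rfl | ⟨c, hc, rfl⟩
  · simp only [Finset.mem_singleton, Prod.mk_eq_zero] at hz hz'
    rw [hz.1, hz'.1] at h1
    simpa using h1
  · rw [Finset.mem_filter] at hz hz'
    simp only [Finset.mem_univ, true_and, nrm] at hz hz'
    by_contra hne
    have hd : a - a' ≠ 0 := sub_ne_zero.2 hne
    have hx' : x' = x + (a - a') := by linear_combination -h1
    have hy' : y' = y + (a - a') * t := by linear_combination -h3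
    rw [hx', hy'] at hz'
    have : (a - a') * (2 * (x - δ * t * y)) = 0 := by
      linear_combination hz' - hz + (a - a') ^ 2 * ht
    have hx : x = δ * t * y := by
      simpa [hd, h2, sub_eq_zero] using this
    rw [hx] at hz
    exact hc (by rw [← hz]; linear_combination δ * y ^ 2 * ht)

theorem hInner_lineAvg (h2 : (2 : ZMod N) ≠ 0) (t : ZMod N)
    (φ ψ : State N) : hInner (lineAvg (fun z => W (e (z, 0))) t φ) ψ =
      hInner φ (lineAvg (fun z => W (e (z, 0))) t ψ) := by
  simp only [lineAvg, LinearMap.smul_apply, LinearMap.sum_apply, hInner_smul_left,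
    hInner_smul_right, hInner_sum_left, hInner_sum_right, map_inv₀, Complex.conj_natCast]
  congr 1
  refine Fintype.sum_equiv (Equiv.neg _) _ _ fun a => ?_
  rw [hInner_W (odd_of_two_ne_zero h2), ← map_neg]
  simp

/-- The operator averaging the Weyl operators over the image of `O₁ × O₂`. -/
noncomputable def orbitAvg (e : (ZMod N × ZMod N) × (ZMod N × ZMod N) ≃+ Vec (ZMod N))
    (O₁ O₂ : Finset (ZMod N × ZMod N)) : Module.End ℂ (State N) :=
  ((O₁.card * O₂.card : ℝ) : ℂ)⁻¹ • ∑ z ∈ O₁ ×ˢ O₂, W (e z)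

theorem orbitAvg_swap (O₁ O₂ : Finset (ZMod N × ZMod N)) :
    orbitAvg (AddEquiv.prodComm.trans e) O₂ O₁ = orbitAvg e O₁ O₂ := by
  rw [orbitAvg, orbitAvg, mul_comm (O₂.card : ℝ)]
  congr 1
  refine Finset.sum_nbij' Prod.swap Prod.swap ?_ ?_ ?_ ?_ ?_ <;> simp +contextual

theorem norm_stdAddChar (x : ZMod N) : ‖(ZMod.stdAddChar x : ℂ)‖ = 1 := by
  rw [ZMod.stdAddChar_apply, Circle.norm_coe]

theorem natCast_pos_real : 0 < (N : ℝ) := Nat.cast_pos.2 (Fact.out : N.Prime).pos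

theorem card_product_real {α β : Type*} (O₁ : Finset α) (O₂ : Finset β) :
    ((O₁ ×ˢ O₂).card : ℝ) = O₁.card * O₂.card := by
  rw [Finset.card_product]; push_cast; rfl

variable {ι : Type*} [Fintype ι] [DecidableEq ι] {φ : Module.Basis ι ℂ (State N)}
  {O₁ O₂ : Finset (ZMod N × ZMod N)}

theorem sum_stateNormSq_orbitAvg (hφ : ∀ i j, hInner (φ i) (φ j) = if i = j then 1 else 0)
    (h2 : (2 : ZMod N) ≠ 0) (h₁ : O₁.Nonempty) (h₂ : O₂.Nonempty) :
    ∑ j, stateNormSq (orbitAvg e O₁ O₂ (φ j)) = (N : ℝ) ^ 2 / (O₁.card * O₂.card) := by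
  have hc₁ : (O₁.card : ℝ) ≠ 0 := by exact_mod_cast h₁.card_pos.ne'
  have hc₂ : (O₂.card : ℝ) ≠ 0 := by exact_mod_cast h₂.card_pos.ne'
  rw [orbitAvg, Finset.smul_sum, sum_stateNormSq_eq φ hφ h2 _ _ _ e.injective.injOn,
    Finset.sum_const, nsmul_eq_mul, card_product_real, norm_inv, Complex.norm_real,
    Real.norm_eq_abs, abs_of_nonneg (by positivity)]
  field_simp

/-- The product is a sum of `N |O₁| |O₂|` distinct Weyl operators with coefficients of modulus `1 /
(N |O₁| |O₂|)`. Compared with the orbit average alone this gains a factor `1/N`, the source of the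
error term. -/
theorem sum_stateNormSq_orbitAvg_lineAvg
    (hφ : ∀ i j, hInner (φ i) (φ j) = if i = j then 1 else 0)
    (h2 : (2 : ZMod N) ≠ 0) (hO₁ : IsNormOrbit δ₁ O₁) (h₁ : O₁.Nonempty) (h₂ : O₂.Nonempty)
    {t : ZMod N} (ht : t ^ 2 * δ₁ = 1) :
    ∑ j, stateNormSq (orbitAvg e O₁ O₂ (lineAvg (fun z => W (e (z, 0))) t (φ j))) =
      N / (O₁.card * O₂.card) := by
  have hc₁ : (O₁.card : ℝ) ≠ 0 := by exact_mod_cast h₁.card_pos.ne'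
  have hc₂ : (O₂.card : ℝ) ≠ 0 := by exact_mod_cast h₂.card_pos.ne'
  have hN := natCast_pos_real (N := N)
  set n : ℝ := O₁.card * O₂.card
  have key : orbitAvg e O₁ O₂ * lineAvg (fun z => W (e (z, 0))) t =
      ∑ p ∈ (O₁ ×ˢ O₂) ×ˢ Finset.univ, (((n : ℂ)⁻¹ * (N : ℂ)⁻¹) *
        (ZMod.stdAddChar (2⁻¹ * omega (e p.1) (e ((p.2, p.2 * t), 0))) : ℂ)) •
        W (e (p.1 + ((p.2, p.2 * t), 0))) := by
    rw [orbitAvg, lineAvg, smul_mul_smul_comm, Finset.sum_mul_sum, ← Finset.sum_product',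
      Finset.smul_sum]
    refine Finset.sum_congr rfl fun p _ => ?_
    rw [W_mul (odd_of_two_ne_zero h2), smul_smul, map_add]
  have hinj : Set.InjOn (fun p : ((ZMod N × ZMod N) × (ZMod N × ZMod N)) × ZMod N =>
      e (p.1 + ((p.2, p.2 * t), 0))) ↑((O₁ ×ˢ O₂) ×ˢ (Finset.univ : Finset (ZMod N))) := by
    rintro ⟨⟨u, v⟩, a⟩ hp ⟨⟨u', v'⟩, a'⟩ hp' h
    have h := e.injective h
    simp only [Finset.coe_product, Set.mem_prod, Finset.mem_coe] at hp hp'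
    simp only [Prod.mk_add_mk, add_zero, Prod.mk.injEq] at h
    obtain ⟨rfl, rfl⟩ := hO₁.line_inj h2 ht hp.1.1 hp'.1.1 h.1
    rw [h.2]
  have := sum_stateNormSq_eq φ hφ h2 ((O₁ ×ˢ O₂) ×ˢ Finset.univ) (fun p => ((n : ℂ)⁻¹ * (N : ℂ)⁻¹) *
        (ZMod.stdAddChar (2⁻¹ * omega (e p.1) (e ((p.2, p.2 * t), 0))) : ℂ)) _ hinj
  rw [← key] at this
  simp only [Module.End.mul_apply, norm_mul, norm_stdAddChar, mul_one, Finset.sum_const,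
    nsmul_eq_mul, card_product_real, norm_inv, Complex.norm_real, Complex.norm_natCast,
    Finset.card_univ, ZMod.card, Real.norm_eq_abs] at this
  rw [this, abs_of_nonneg (by positivity)]
  simp only [n]
  field_simp

theorem hInner_orbitAvg_adjoint (h2 : (2 : ZMod N) ≠ 0) (a b : State N) :
    hInner ((((O₁.card * O₂.card : ℝ) : ℂ)⁻¹ • ∑ z ∈ O₁ ×ˢ O₂, W (-(e z))) a) b =
      hInner a (orbitAvg e O₁ O₂ b) := by
  simp only [orbitAvg, LinearMap.smul_apply, LinearMap.sum_apply, hInner_smul_left,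
    hInner_smul_right, hInner_sum_left, hInner_sum_right, map_inv₀, Complex.conj_ofReal]
  congr 1
  refine Finset.sum_congr rfl fun z _ => ?_
  rw [hInner_W (odd_of_two_ne_zero h2), neg_neg]

open Classical in
/-- The exceptional eigenfunctions, those not killed by the averages over isotropic eigenlines,
contribute little to the Hilbert–Schmidt norm of `orbitAvg`. -/
theorem IsHeckeFrame.sum_exceptional_le (he : IsHeckeFrame C δ₁ δ₂ q₁ q₂ e)
    (hφ : ∀ i j, hInner (φ i) (φ j) = if i = j then 1 else 0)
    (hC : ∀ j, IsHeckeEigenfunction C (φ j)) (hq : q₁ ≠ 0)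
    (h2 : (2 : ZMod N) ≠ 0) (hO₁ : IsNormOrbit δ₁ O₁) (h₁ : O₁.Nonempty) (h₂ : O₂.Nonempty) :
    ∑ j with ∃ t, t ^ 2 * δ₁ = 1 ∧ lineAvg (fun z => W (e (z, 0))) t (φ j) ≠ 0,
      stateNormSq (orbitAvg e O₁ O₂ (φ j)) ≤
        4 * (N : ℝ) ^ 2 / ((N - 1) * (O₁.card * O₂.card)) := by
  have hN := natCast_pos_real (N := N)
  have hN1 : (0 : ℝ) < N - 1 := by
    have : (1 : ℝ) < N := by exact_mod_cast (Fact.out : N.Prime).one_lt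
    linarith
  have hc₁ : (0 : ℝ) < O₁.card := by exact_mod_cast h₁.card_pos
  have hc₂ : (0 : ℝ) < O₂.card := by exact_mod_cast h₂.card_pos
  by_cases hex : ∃ t, t ^ 2 * δ₁ = 1
  swap
  · rw [Finset.filter_false_of_mem fun j _ h => hex (h.imp fun _ h => h.1), Finset.sum_empty]
    positivity
  obtain ⟨s, hs⟩ := hex
  have hδ : δ₁ ≠ 0 := by rintro rfl; simp at hs
  have hs' : (-s) ^ 2 * δ₁ = 1 := by rwa [neg_sq]
  set w : ZMod N × ZMod N → Module.End ℂ (State N) := fun z => W (e (z, 0))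
  set D := orbitAvg e O₁ O₂
  set M := lineAvg w s - lineAvg w (-s) with hM
  have hroots : ∀ t, t ^ 2 * δ₁ = 1 → t = s ∨ t = -s := fun t ht =>
    sq_eq_sq_iff_eq_or_eq_neg.1 (mul_right_cancel₀ hδ (ht.trans hs.symm))
  -- With `M = P - Q`, the operator `M²` is `1 - 1/N` on exceptional eigenfunctions and `0` on the
  -- others. The exceptional sum is thus a multiple of the trace of `D* D M²`, which by cyclicity is
  -- the squared Hilbert–Schmidt norm of `D M`.
  have hterm : ∀ j, hInner (D (M (M (φ j)))) (D (φ j)) =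
      if ∃ t, t ^ 2 * δ₁ = 1 ∧ lineAvg w t (φ j) ≠ 0 then
        (1 - (N : ℂ)⁻¹) * stateNormSq (D (φ j)) else 0 := by
    intro j
    split_ifs with hj
    · rcases lineAvg_dichotomy (he.isWeylSystem h2) hq h2
        (fun t ht => he.exists_gaussSum_eigenvalue h2 (hC j) t ht) hs with h | h
      · obtain ⟨t, ht, h0⟩ := hj
        rcases hroots t ht with rfl | rfl
        · exact absurd h.1 h0
        · exact absurd h.2 h0
      · rw [h, map_smul, hInner_smul_left, hInner_self]
    · push Not at hj
      have : M (φ j) = 0 := by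
        rw [hM, LinearMap.sub_apply, hj s hs, hj (-s) hs', sub_zero]
      rw [this, map_zero, map_zero]
      simp [hInner]
  have hMadj : ∀ a b, hInner (M a) b = hInner a (M b) := fun a b => by
    simp only [hM, LinearMap.sub_apply, hInner_sub_left, hInner_sub_right, w,
      hInner_lineAvg h2]
  have htr := sum_hInner_mul_sq φ hφ (hInner_orbitAvg_adjoint (e := e) (O₁ := O₁) (O₂ := O₂) h2)
    hMadj
  simp only [D] at hterm
  simp only [hterm, ← Finset.sum_filter, ← Finset.mul_sum] at htr
  have htr' : (1 - (N : ℝ)⁻¹) * ∑ j with ∃ t, t ^ 2 * δ₁ = 1 ∧ lineAvg w t (φ j) ≠ 0,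
      stateNormSq (D (φ j)) = ∑ j, stateNormSq (D (M (φ j))) := by
    refine Complex.ofReal_injective ?_
    push_cast
    exact htr
  have hle : ∑ j, stateNormSq (D (M (φ j))) ≤ 4 * (N / (O₁.card * O₂.card)) := by
    calc ∑ j, stateNormSq (D (M (φ j)))
        ≤ ∑ j, (2 * stateNormSq (D (lineAvg w s (φ j))) +
            2 * stateNormSq (D (lineAvg w (-s) (φ j)))) := by
          refine Finset.sum_le_sum fun j _ => ?_
          rw [hM, LinearMap.sub_apply, map_sub]
          exact stateNormSq_sub_le _ _
      _ = _ := by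
          rw [Finset.sum_add_distrib, ← Finset.mul_sum, ← Finset.mul_sum,
            sum_stateNormSq_orbitAvg_lineAvg hφ h2 hO₁ h₁ h₂ hs,
            sum_stateNormSq_orbitAvg_lineAvg hφ h2 hO₁ h₁ h₂ hs']
          ring
  rw [← htr'] at hle
  have hpos : 0 < 1 - (N : ℝ)⁻¹ := by
    have : 1 - (N : ℝ)⁻¹ = (N - 1) / N := by field_simp
    rw [this]; positivity
  rw [← le_div_iff₀' hpos] at hle
  refine hle.trans (le_of_eq ?_)
  have : 1 - (N : ℝ)⁻¹ = (N - 1) / N := by field_simp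
  rw [this]
  field_simp

theorem IsHeckeFrame.exists_orbitSum_eigenvalue (he : IsHeckeFrame C δ₁ δ₂ q₁ q₂ e)
    {φ : State N} (hC : IsHeckeEigenfunction C φ) (hq : q₁ ≠ 0)
    (h2 : (2 : ZMod N) ≠ 0) (hO₁ : IsNormOrbit δ₁ O₁)
    (hline : ¬ ∃ t, t ^ 2 * δ₁ = 1 ∧ lineAvg (fun z => W (e (z, 0))) t φ ≠ 0) :
    ∃ s : ℂ, (∑ z ∈ O₁, W (e (z, 0))) φ = s • φ := by
  rcases hO₁ with rfl | ⟨c, -, rfl⟩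
  · refine ⟨1, ?_⟩
    rw [Finset.sum_singleton, one_smul, (he.isWeylSystem h2).zero]
    rfl
  · push Not at hline
    exact sum_nrm_apply (he.isWeylSystem h2) hq h2
      (fun t ht => he.exists_gaussSum_eigenvalue h2 hC t ht) hline c

open Classical in
-- The expectation of `W (e z)` equals that of its orbit average. The upper bound is Cauchy–Schwarz;
-- the lower bound loses only the exceptional eigenfunctions, `4 N² / ((N - 1) |O₁| |O₂|)` for each
-- plane.
theorem IsHeckeFrame.sum_norm_hInner_sq (he : IsHeckeFrame C δ₁ δ₂ q₁ q₂ e)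
    (hφ : ∀ i j, hInner (φ i) (φ j) = if i = j then 1 else 0)
    (hC : ∀ j, IsHeckeEigenfunction C (φ j)) (hq₁ : q₁ ≠ 0) (hq₂ : q₂ ≠ 0)
    (h2 : (2 : ZMod N) ≠ 0) (hO₁ : IsNormOrbit δ₁ O₁) (hO₂ : IsNormOrbit δ₂ O₂)
    {z : (ZMod N × ZMod N) × (ZMod N × ZMod N)} (hz₁ : z.1 ∈ O₁) (hz₂ : z.2 ∈ O₂) :
    ∑ j, ‖hInner (W (e z) (φ j)) (φ j)‖ ^ 2 ≤ (N : ℝ) ^ 2 / (O₁.card * O₂.card) ∧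
    (N : ℝ) ^ 2 / (O₁.card * O₂.card) - 8 * (N : ℝ) ^ 2 / ((N - 1) * (O₁.card * O₂.card)) ≤
      ∑ j, ‖hInner (W (e z) (φ j)) (φ j)‖ ^ 2 := by
  have h₁ : O₁.Nonempty := ⟨_, hz₁⟩
  have h₂ : O₂.Nonempty := ⟨_, hz₂⟩
  have hc₁ : (O₁.card : ℝ) ≠ 0 := by exact_mod_cast h₁.card_pos.ne'
  have hc₂ : (O₂.card : ℝ) ≠ 0 := by exact_mod_cast h₂.card_pos.ne'
  set D := orbitAvg e O₁ O₂ with hD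
  have hunit : ∀ j, stateNormSq (φ j) = 1 := fun j => by
    have := hφ j j
    rw [if_pos rfl, hInner_self] at this
    exact_mod_cast this
  have hexp : ∀ j, hInner (W (e z) (φ j)) (φ j) = hInner (D (φ j)) (φ j) := by
    intro j
    have hconst : ∀ u ∈ O₁ ×ˢ O₂, hInner (W (e u) (φ j)) (φ j) =
        hInner (W (e z) (φ j)) (φ j) := by
      intro u hu
      rw [Finset.mem_product] at hu
      obtain ⟨g₁, hg₁, h₁⟩ := hO₁.exists_quadMul hz₁ hu.1
      obtain ⟨g₂, hg₂, h₂⟩ := hO₂.exists_quadMul hz₂ hu.2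
      obtain ⟨B, hB, hact⟩ := he.exists_mem g₁ g₂ hg₁ hg₂
      have : e u = e z ᵥ* B.1 := by rw [hact, h₁, h₂]
      rw [this, (hC j).hInner_W h2 hB]
    rw [hD, orbitAvg]
    simp only [LinearMap.smul_apply, LinearMap.sum_apply, hInner_smul_left, hInner_sum_left]
    rw [Finset.sum_congr rfl hconst, Finset.sum_const, nsmul_eq_mul, Finset.card_product]
    have hc₁' : (O₁.card : ℂ) ≠ 0 := by exact_mod_cast h₁.card_pos.ne'
    have hc₂' : (O₂.card : ℂ) ≠ 0 := by exact_mod_cast h₂.card_pos.ne'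
    push_cast
    field_simp
  simp only [hexp]
  have hle : ∀ j, ‖hInner (D (φ j)) (φ j)‖ ^ 2 ≤ stateNormSq (D (φ j)) := fun j => by
    have := norm_hInner_sq_le (D (φ j)) (φ j)
    rwa [hunit, mul_one] at this
  have htot : ∑ j, stateNormSq (D (φ j)) = (N : ℝ) ^ 2 / (O₁.card * O₂.card) :=
    sum_stateNormSq_orbitAvg hφ h2 h₁ h₂
  refine ⟨(Finset.sum_le_sum fun j _ => hle j).trans htot.le, ?_⟩
  set e' : (ZMod N × ZMod N) × (ZMod N × ZMod N) ≃+ Vec (ZMod N) := AddEquiv.prodComm.trans e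
  have he' : IsHeckeFrame C δ₂ δ₁ q₂ q₁ e' := he.swap
  set p₁ : ι → Prop := fun j => ∃ t, t ^ 2 * δ₁ = 1 ∧ lineAvg (fun z => W (e (z, 0))) t (φ j) ≠ 0
    with hp₁
  set p₂ : ι → Prop := fun j => ∃ t, t ^ 2 * δ₂ = 1 ∧ lineAvg (fun z => W (e' (z, 0))) t (φ j) ≠ 0
    with hp₂
  have hb₁ := he.sum_exceptional_le (O₂ := O₂) hφ hC hq₁ h2 hO₁ h₁ h₂
  have hb₂ := he'.sum_exceptional_le (O₂ := O₁) hφ hC hq₂ h2 hO₂ h₂ h₁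
  rw [orbitAvg_swap, mul_comm (O₂.card : ℝ)] at hb₂
  -- Exceptional eigenfunctions are charged in full. Any other is an eigenvector of the orbit sum in
  -- both planes, hence of `D`, and Cauchy–Schwarz is an equality.
  have hpt : ∀ j, stateNormSq (D (φ j)) ≤ ‖hInner (D (φ j)) (φ j)‖ ^ 2 +
      (if p₁ j then stateNormSq (D (φ j)) else 0) +
      (if p₂ j then stateNormSq (D (φ j)) else 0) := by
    intro j
    have hnn := stateNormSq_nonneg (D (φ j))
    have hnn' : 0 ≤ ‖hInner (D (φ j)) (φ j)‖ ^ 2 := by positivity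
    by_cases hj₁ : p₁ j
    · rw [if_pos hj₁]
      split_ifs <;> linarith
    by_cases hj₂ : p₂ j
    · rw [if_pos hj₂]
      split_ifs; linarith
    rw [if_neg hj₁, if_neg hj₂, add_zero, add_zero]
    obtain ⟨s₁, hs₁⟩ := he.exists_orbitSum_eigenvalue (hC j) hq₁ h2 hO₁ hj₁
    obtain ⟨s₂, hs₂⟩ := he'.exists_orbitSum_eigenvalue (hC j) hq₂ h2 hO₂ hj₂
    have hDj : ∃ s : ℂ, D (φ j) = s • φ j := by
      refine ⟨((O₁.card * O₂.card : ℝ) : ℂ)⁻¹ * (s₂ * s₁), ?_⟩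
      have hsum : ∑ u ∈ O₁ ×ˢ O₂, W (e u) =
          (∑ u ∈ O₁, W (e (u, 0))) * ∑ u ∈ O₂, W (e' (u, 0)) := by
        rw [Finset.sum_mul_sum, ← Finset.sum_product']
        exact Finset.sum_congr rfl fun u _ => he.W_eq_mul h2 u
      rw [hD, orbitAvg, hsum, LinearMap.smul_apply, Module.End.mul_apply, hs₂, map_smul, hs₁,
        smul_smul, smul_smul, mul_assoc]
    obtain ⟨s, hs⟩ := hDj
    rw [hs, hInner_smul_left, stateNormSq_smul, hInner_self, hunit]
    simp
  have hsum := Finset.sum_le_sum fun j (_ : j ∈ Finset.univ) => hpt j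
  rw [Finset.sum_add_distrib, Finset.sum_add_distrib, ← Finset.sum_filter, ← Finset.sum_filter,
    htot] at hsum
  have : 8 * (N : ℝ) ^ 2 / ((N - 1) * (O₁.card * O₂.card)) =
    4 * (N : ℝ) ^ 2 / ((N - 1) * (O₁.card * O₂.card)) +
    4 * (N : ℝ) ^ 2 / ((N - 1) * (O₁.card * O₂.card)) := by ring
  linarith

end Frame

/-! ### Orbit sizes and the variance of a plane wave -/

section Variance

variable {N : ℕ} [Fact N.Prime]

theorem integral_fourier_haar (k : ℤ) :
    ∫ x : UnitAddCircle, fourier k x ∂AddCircle.haarAddCircle = if k = 0 then (1 : ℂ) else 0 := by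
  have h := orthonormal_iff_ite.mp (orthonormal_fourier (T := (1 : ℝ))) 0 k
  simp only [ContinuousMap.inner_toLp] at h
  simp only [eq_comm (a := k)]
  rw [← h]
  refine integral_congr_ae (Filter.Eventually.of_forall fun x => ?_)
  simp

theorem integral_mFourier_haar (m : Vec ℤ) :
    ∫ x, UnitAddTorus.mFourier m x ∂(Measure.pi fun _ : Fin 2 ⊕ Fin 2 =>
      (AddCircle.haarAddCircle : Measure UnitAddCircle)) = if m = 0 then (1 : ℂ) else 0 := by
  simp only [UnitAddTorus.mFourier, ContinuousMap.coe_mk]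
  rw [integral_fintype_prod_eq_prod (f := fun i (x : UnitAddCircle) => (fourier (m i) x : ℂ))]
  simp only [integral_fourier_haar]
  split_ifs with h
  · simp [h]
  · obtain ⟨i, hi⟩ := Function.ne_iff.1 h
    exact Finset.prod_eq_zero (Finset.mem_univ i) (if_neg hi)

theorem torusMean_mFourier {n : Vec ℤ} (hn : n ≠ 0) : torusMean (UnitAddTorus.mFourier n) = 0 := by
  rw [torusMean, integral_mFourier_haar, if_neg hn]

theorem mFourierCoeff_mFourier (n m : Vec ℤ) :
    UnitAddTorus.mFourierCoeff (UnitAddTorus.mFourier n : UnitAddTorus (Fin 2 ⊕ Fin 2) → ℂ) m =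
      if m = n then 1 else 0 := by
  have h : UnitAddTorus.mFourierCoeff
      (UnitAddTorus.mFourier n : UnitAddTorus (Fin 2 ⊕ Fin 2) → ℂ) m =
      ∫ x, UnitAddTorus.mFourier (-m + n) x ∂(Measure.pi fun _ : Fin 2 ⊕ Fin 2 =>
      (AddCircle.haarAddCircle : Measure UnitAddCircle)) := by
    simp only [UnitAddTorus.mFourier_add]
    rfl
  rw [h, integral_mFourier_haar]
  simp only [neg_add_eq_zero]

theorem Op_mFourier (n : Vec ℤ) (φ : State N) : Op N (UnitAddTorus.mFourier n) φ = T N n φ := by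
  rw [Op, tsum_eq_single n fun m hm => by rw [mFourierCoeff_mFourier, if_neg hm, zero_smul],
    mFourierCoeff_mFourier, if_pos rfl, one_smul]

theorem S2_mFourier (h2 : (2 : ZMod N) ≠ 0) {n : Vec ℤ} (hn : n ≠ 0)
    (φ : Module.Basis (Fin (N ^ 2)) ℂ (State N)) :
    S2 (UnitAddTorus.mFourier n) N φ =
      (1 / (N : ℝ) ^ 2) * ∑ j, ‖hInner (W (redVec N n) (φ j)) (φ j)‖ ^ 2 := by
  rw [S2]
  congr 1
  refine Finset.sum_congr rfl fun j _ => ?_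
  rw [torusMean_mFourier hn, sub_zero, Op_mFourier, T_eq_W (odd_of_two_ne_zero h2),
    LinearMap.smul_apply, hInner_smul_left, norm_mul, norm_zpow, norm_neg, norm_one, one_zpow,
    one_mul]

open Classical in
-- Rational parametrization of the conic `x² - δ y² = 1` by the lines `y = t (x + 1)` through `(-1,
-- 0)`. The base point itself accounts for the `1`.
theorem card_nrm_eq_one (h2 : (2 : ZMod N) ≠ 0) {δ : ZMod N} (hδ : δ ≠ 0) :
    (Finset.univ.filter fun z : ZMod N × ZMod N => nrm δ z = 1).card =
      1 + (Finset.univ.filter fun t : ZMod N => t ^ 2 * δ ≠ 1).card := by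
  have hh : (2 : ZMod N) * 2⁻¹ = 1 := mul_inv_cancel₀ h2
  set f : ZMod N → ZMod N × ZMod N :=
    fun t => ((1 + t ^ 2 * δ) * (1 - t ^ 2 * δ)⁻¹, 2 * t * (1 - t ^ 2 * δ)⁻¹) with hf
  set S := Finset.univ.filter fun t : ZMod N => t ^ 2 * δ ≠ 1 with hS
  have hm : ∀ t ∈ S, (1 - t ^ 2 * δ) * (1 - t ^ 2 * δ)⁻¹ = 1 := fun t ht =>
    mul_inv_cancel₀ (sub_ne_zero.2 (Ne.symm (Finset.mem_filter.1 ht).2))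
  have hset : (Finset.univ.filter fun z : ZMod N × ZMod N => nrm δ z = 1) =
      insert (-1, 0) (S.image f) := by
    ext ⟨x, y⟩
    rw [Finset.mem_filter, Finset.mem_insert, Finset.mem_image]
    simp only [Finset.mem_univ, true_and, Prod.mk.injEq, nrm, hf]
    constructor
    · intro h
      by_cases hx : 1 + x = 0
      · left
        have hx : x = -1 := by linear_combination hx
        subst hx
        have h' : δ * y ^ 2 = 0 := by linear_combination -h
        exact ⟨rfl, by simpa [hδ] using h'⟩
      · right
        have hi : (1 + x) * (1 + x)⁻¹ = 1 := mul_inv_cancel₀ hx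
        have hi0 : (1 + x)⁻¹ ≠ 0 := inv_ne_zero hx
        have hinv : (1 + x)⁻¹⁻¹ = 1 + x := inv_inv _
        set i := (1 + x)⁻¹
        have e : 1 - (y * i) ^ 2 * δ = 2 * i := by
          linear_combination i ^ 2 * h - (i * (1 + x) + 1 - 2 * i) * hi
        refine ⟨y * i, Finset.mem_filter.2 ⟨Finset.mem_univ _, fun h0 => ?_⟩, ?_, ?_⟩
        · rw [h0, sub_self] at e
          exact mul_ne_zero h2 hi0 e.symm
        · rw [e, mul_inv, hinv]
          linear_combination -(2⁻¹ * (1 + x)) * e - 2 * 2⁻¹ * hi + x * hh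
        · rw [e, mul_inv, hinv]
          linear_combination 2 * 2⁻¹ * y * hi + y * hh
    · rintro (⟨rfl, rfl⟩ | ⟨t, ht, rfl, rfl⟩)
      · ring
      · have := hm t ht
        linear_combination ((1 - t ^ 2 * δ) * (1 - t ^ 2 * δ)⁻¹ + 1) * this
  have hnot : (-1, 0) ∉ S.image f := by
    rw [Finset.mem_image]
    rintro ⟨t, ht, h⟩
    simp only [hf, Prod.mk.injEq] at h
    have hmt := hm t ht
    have h0 : (1 - t ^ 2 * δ)⁻¹ ≠ 0 := right_ne_zero_of_mul_eq_one hmt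
    have : 2 * (1 - t ^ 2 * δ)⁻¹ = 0 := by linear_combination h.1 + hmt
    exact mul_ne_zero h2 h0 this
  have hinj : Set.InjOn f S := by
    intro t ht t' ht' h
    simp only [hf, Prod.mk.injEq] at h
    have hmt := hm t ht
    have hmt' := hm t' ht'
    have h0 : (1 - t ^ 2 * δ)⁻¹ ≠ 0 := right_ne_zero_of_mul_eq_one hmt
    have hmm : (1 - t ^ 2 * δ)⁻¹ = (1 - t' ^ 2 * δ)⁻¹ := by
      refine mul_left_cancel₀ h2 ?_
      linear_combination h.1 + hmt - hmt'
    have h3 := h.2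
    rw [← hmm] at h3
    exact mul_left_cancel₀ h2 (mul_right_cancel₀ h0 h3)
  rw [hset, Finset.card_insert_of_notMem hnot, Finset.card_image_of_injOn hinj, add_comm]

open Classical in
-- Multiplication by `z` maps the norm-one set bijectively onto the level set of `z`, and `t² δ = 1`
-- has at most two solutions.
theorem card_nrm_eq (h2 : (2 : ZMod N) ≠ 0) {δ : ZMod N} (hδ : δ ≠ 0) {z : ZMod N × ZMod N}
    (hz : nrm δ z ≠ 0) :
    N ≤ (Finset.univ.filter fun u : ZMod N × ZMod N => nrm δ u = nrm δ z).card + 1 ∧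
      (Finset.univ.filter fun u : ZMod N × ZMod N => nrm δ u = nrm δ z).card ≤ N + 1 := by
  have hcard : (Finset.univ.filter fun u : ZMod N × ZMod N => nrm δ u = nrm δ z).card =
      (Finset.univ.filter fun u : ZMod N × ZMod N => nrm δ u = 1).card := by
    symm
    refine Finset.card_bij (fun g _ => quadMul δ z g) ?_ ?_ ?_
    · intro g hg
      rw [Finset.mem_filter] at hg ⊢
      refine ⟨Finset.mem_univ _, ?_⟩
      have := hg.2
      simp only [nrm, quadMul] at this ⊢
      linear_combination (z.1 ^ 2 - δ * z.2 ^ 2) * this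
    · intro g _ g' _ h
      obtain ⟨h1, h3⟩ := Prod.ext_iff.1 h
      simp only [quadMul] at h1 h3
      simp only [nrm] at hz
      ext
      · exact mul_left_cancel₀ hz (by linear_combination z.1 * h1 - δ * z.2 * h3)
      · exact mul_left_cancel₀ hz (by linear_combination z.1 * h3 - z.2 * h1)
    · intro u hu
      rw [Finset.mem_filter] at hu
      obtain ⟨g, hg, h⟩ := IsNormOrbit.exists_quadMul (δ := δ) (z := z) (z' := u)
        (Or.inr ⟨_, hz, rfl⟩) (by simp) (by simpa using hu.2)
      exact ⟨g, by simpa using hg, h⟩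
  rw [hcard, card_nrm_eq_one h2 hδ]
  have hN : (Finset.univ.filter fun t : ZMod N => t ^ 2 * δ = 1).card +
      (Finset.univ.filter fun t : ZMod N => t ^ 2 * δ ≠ 1).card = N := by
    rw [Finset.card_filter_add_card_filter_not, Finset.card_univ, ZMod.card]
  have hle : (Finset.univ.filter fun t : ZMod N => t ^ 2 * δ = 1).card ≤ 2 := by
    by_cases h : ∃ s, s ^ 2 * δ = 1
    · obtain ⟨s, hs⟩ := h
      refine (Finset.card_le_card (t := {s, -s}) fun t ht => ?_).trans Finset.card_le_two
      rw [Finset.mem_filter] at ht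
      rw [Finset.mem_insert, Finset.mem_singleton]
      exact sq_eq_sq_iff_eq_or_eq_neg.1 (mul_right_cancel₀ hδ (ht.2.trans hs.symm))
    · rw [Finset.filter_false_of_mem fun t _ ht => h ⟨t, ht⟩]
      simp
  omega

theorem abs_sub_one_div_le {N S n : ℝ} (hN : 3 ≤ N) (hn : 0 < n)
    (h1 : N ^ 2 * S ≤ N ^ 2 / n) (h2 : N ^ 2 / n - 8 * N ^ 2 / ((N - 1) * n) ≤ N ^ 2 * S) :
    |S - 1 / n| ≤ 16 / (N * n) := by
  have hN2 : 0 < N ^ 2 := by positivity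
  have h3 : S ≤ 1 / n := le_of_mul_le_mul_left (h1.trans (le_of_eq (by ring))) hN2
  have h4 : 1 / n - 8 / ((N - 1) * n) ≤ S :=
    le_of_mul_le_mul_left ((le_of_eq (by ring)).trans h2) hN2
  have h5 : 8 / ((N - 1) * n) ≤ 16 / (N * n) := by
    rw [div_le_div_iff₀ (by nlinarith) (by positivity)]
    nlinarith
  have h6 : 0 ≤ 16 / (N * n) := by positivity
  rw [abs_le]
  constructor <;> linarith

theorem abs_sub_one_div_le_of_single {N S n : ℝ} (hN : 3 ≤ N) (hn1 : N - 1 ≤ n)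
    (hn2 : n ≤ N + 1) (h : |S - 1 / n| ≤ 16 / (N * n)) : |S - 1 / N| ≤ 100 / N ^ 2 := by
  have hN0 : 0 < N := by linarith
  have hn0 : N / 2 ≤ n := by linarith
  have hn : 0 < n := by linarith
  have h1 : 16 / (N * n) ≤ 32 / N ^ 2 := by
    rw [div_le_div_iff₀ (by positivity) (by positivity)]
    nlinarith
  have h2 : |1 / n - 1 / N| ≤ 2 / N ^ 2 := by
    have : 1 / n - 1 / N = (N - n) / (n * N) := by field_simp
    rw [this, abs_div, abs_of_pos (show 0 < n * N by positivity),
      div_le_div_iff₀ (by positivity) (by positivity)]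
    have h3 : |N - n| ≤ 1 := abs_le.2 ⟨by linarith, by linarith⟩
    nlinarith [mul_le_mul_of_nonneg_right h3 (sq_nonneg N)]
  calc |S - 1 / N| ≤ |S - 1 / n| + |1 / n - 1 / N| := abs_sub_le _ _ _
    _ ≤ 32 / N ^ 2 + 2 / N ^ 2 := add_le_add (h.trans h1) h2
    _ = 34 / N ^ 2 := by ring
    _ ≤ 100 / N ^ 2 := by gcongr; norm_num

theorem abs_sub_one_div_sq_le_of_double {N S a b : ℝ} (hN : 3 ≤ N) (ha1 : N - 1 ≤ a)
    (ha2 : a ≤ N + 1) (hb1 : N - 1 ≤ b) (hb2 : b ≤ N + 1)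
    (h : |S - 1 / (a * b)| ≤ 16 / (N * (a * b))) : |S - 1 / N ^ 2| ≤ 100 / N ^ 3 := by
  have hN0 : 0 < N := by linarith
  have ha0 : N / 2 ≤ a := by linarith
  have hb0 : N / 2 ≤ b := by linarith
  have ha : 0 < a := by linarith
  have hb : 0 < b := by linarith
  have hab : N ^ 2 ≤ 4 * (a * b) := by nlinarith
  have h1 : 16 / (N * (a * b)) ≤ 64 / N ^ 3 := by
    rw [div_le_div_iff₀ (by positivity) (by positivity)]
    nlinarith
  have h2 : |1 / (a * b) - 1 / N ^ 2| ≤ 12 / N ^ 3 := by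
    have : 1 / (a * b) - 1 / N ^ 2 = (N ^ 2 - a * b) / (a * b * N ^ 2) := by field_simp
    rw [this, abs_div, abs_of_pos (show 0 < a * b * N ^ 2 by positivity),
      div_le_div_iff₀ (by positivity) (by positivity)]
    have h3 : |N ^ 2 - a * b| ≤ 3 * N := abs_le.2 ⟨by nlinarith, by nlinarith⟩
    calc |N ^ 2 - a * b| * N ^ 3 ≤ 3 * N * N ^ 3 := by gcongr
      _ = 3 * N ^ 2 * N ^ 2 := by ring
      _ ≤ 3 * N ^ 2 * (4 * (a * b)) := by gcongr
      _ = 12 * (a * b * N ^ 2) := by ring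
  calc |S - 1 / N ^ 2| ≤ |S - 1 / (a * b)| + |1 / (a * b) - 1 / N ^ 2| := abs_sub_le _ _ _
    _ ≤ 64 / N ^ 3 + 12 / N ^ 3 := add_le_add (h.trans h1) h2
    _ = 76 / N ^ 3 := by ring
    _ ≤ 100 / N ^ 3 := by gcongr; norm_num

/-- The variance of a plane wave in a Hecke basis, in terms of its two components. -/
theorem IsHeckeFrame.abs_S2_sub_le {C : Subgroup (Sp4 (ZMod N))} {δ₁ δ₂ q₁ q₂ : ZMod N}
    {e : (ZMod N × ZMod N) × (ZMod N × ZMod N) ≃+ Vec (ZMod N)}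
    (he : IsHeckeFrame C δ₁ δ₂ q₁ q₂ e) (h2 : (2 : ZMod N) ≠ 0) (hδ₁ : δ₁ ≠ 0) (hδ₂ : δ₂ ≠ 0)
    (hq₁ : q₁ ≠ 0) (hq₂ : q₂ ≠ 0) {φ : Module.Basis (Fin (N ^ 2)) ℂ (State N)}
    (hφ : IsHeckeBasis C φ) {n : Vec ℤ} (hn : n ≠ 0)
    {z : (ZMod N × ZMod N) × (ZMod N × ZMod N)} (hz : redVec N n = e z) :
    (nrm δ₁ z.1 ≠ 0 → z.2 = 0 →
      |S2 (UnitAddTorus.mFourier n) N φ - 1 / (N : ℝ)| ≤ 100 / (N : ℝ) ^ 2) ∧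
    (z.1 = 0 → nrm δ₂ z.2 ≠ 0 →
      |S2 (UnitAddTorus.mFourier n) N φ - 1 / (N : ℝ)| ≤ 100 / (N : ℝ) ^ 2) ∧
    (nrm δ₁ z.1 ≠ 0 → nrm δ₂ z.2 ≠ 0 →
      |S2 (UnitAddTorus.mFourier n) N φ - 1 / (N : ℝ) ^ 2| ≤ 100 / (N : ℝ) ^ 3) := by
  classical
  have hN : (3 : ℝ) ≤ N := by
    obtain ⟨r, hr⟩ := odd_of_two_ne_zero h2
    have := (Fact.out : N.Prime).two_le
    have : 3 ≤ N := by omega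
    exact_mod_cast this
  have hN0 : (N : ℝ) ≠ 0 := by positivity
  have key : ∀ O₁ O₂ : Finset (ZMod N × ZMod N), IsNormOrbit δ₁ O₁ → IsNormOrbit δ₂ O₂ →
      z.1 ∈ O₁ → z.2 ∈ O₂ → |S2 (UnitAddTorus.mFourier n) N φ - 1 / (O₁.card * O₂.card)| ≤
        16 / (N * (O₁.card * O₂.card)) := by
    intro O₁ O₂ hO₁ hO₂ hz₁ hz₂
    have h := he.sum_norm_hInner_sq hφ.1 hφ.2 hq₁ hq₂ h2 hO₁ hO₂ hz₁ hz₂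
    have hc₁ : (0 : ℝ) < O₁.card := by exact_mod_cast Finset.card_pos.2 ⟨_, hz₁⟩
    have hc₂ : (0 : ℝ) < O₂.card := by exact_mod_cast Finset.card_pos.2 ⟨_, hz₂⟩
    have hS : (N : ℝ) ^ 2 * S2 (UnitAddTorus.mFourier n) N φ =
        ∑ j, ‖hInner (W (e z) (φ j)) (φ j)‖ ^ 2 := by
      rw [S2_mFourier h2 hn, hz]
      field_simp
    rw [← hS] at h
    exact abs_sub_one_div_le hN (by positivity) h.1 h.2
  have hbig : ∀ {δ : ZMod N} (_ : δ ≠ 0) {u : ZMod N × ZMod N} (_ : nrm δ u ≠ 0),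
      ∃ O, IsNormOrbit δ O ∧ u ∈ O ∧ (N : ℝ) - 1 ≤ O.card ∧ (O.card : ℝ) ≤ N + 1 := by
    intro δ hδ u hu
    obtain ⟨h1, h3⟩ := card_nrm_eq h2 hδ hu
    refine ⟨Finset.univ.filter fun v => nrm δ v = nrm δ u, Or.inr ⟨_, hu, ?_⟩, by simp, ?_, ?_⟩
    · congr
    · rw [sub_le_iff_le_add]; exact_mod_cast h1
    · exact_mod_cast h3
  refine ⟨fun h₁ h₂ => ?_, fun h₁ h₂ => ?_, fun h₁ h₂ => ?_⟩
  · obtain ⟨O, hO, hm, hl, hu⟩ := hbig hδ₁ h₁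
    have := key O {0} hO (Or.inl rfl) hm (by simp [h₂])
    rw [Finset.card_singleton, Nat.cast_one, mul_one] at this
    exact abs_sub_one_div_le_of_single hN hl hu this
  · obtain ⟨O, hO, hm, hl, hu⟩ := hbig hδ₂ h₂
    have := key {0} O (Or.inl rfl) hO (by simp [h₁]) hm
    rw [Finset.card_singleton, Nat.cast_one, one_mul] at this
    exact abs_sub_one_div_le_of_single hN hl hu this
  · obtain ⟨O, hO, hm, hl, hu⟩ := hbig hδ₁ h₁
    obtain ⟨O', hO', hm', hl', hu'⟩ := hbig hδ₂ h₂
    exact abs_sub_one_div_sq_le_of_double hN hl hu hl' hu' (key O O' hO hO' hm hm')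

end Variance

/-! ### The symplectic form over a commutative ring -/

section Symplectic

variable {R : Type*} [CommRing R]

theorem omega_add_left_ring (u v w : Vec R) : omega (u + v) w = omega u w + omega v w := by
  simp only [omega, dotProduct, Fin.sum_univ_two, Function.comp_apply, Pi.add_apply]; ring

theorem omega_add_right_ring (u v w : Vec R) : omega u (v + w) = omega u v + omega u w := by
  simp only [omega, dotProduct, Fin.sum_univ_two, Function.comp_apply, Pi.add_apply]; ring

theorem omega_smul_left_ring (c : R) (u v : Vec R) : omega (c • u) v = c * omega u v := by
  simp only [omega, dotProduct, Fin.sum_univ_two, Function.comp_apply, Pi.smul_apply, smul_eq_mul]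
  ring

theorem omega_smul_right_ring (c : R) (u v : Vec R) : omega u (c • v) = c * omega u v := by
  simp only [omega, dotProduct, Fin.sum_univ_two, Function.comp_apply, Pi.smul_apply, smul_eq_mul]
  ring

theorem omega_self_ring (u : Vec R) : omega u u = 0 := by
  simp only [omega, dotProduct, Fin.sum_univ_two, Function.comp_apply]; ring

theorem omega_swap_ring (u v : Vec R) : omega u v = -omega v u := by
  simp only [omega, dotProduct, Fin.sum_univ_two, Function.comp_apply]; ring

theorem omega_eq_dotProduct_J (u v : Vec R) :
    omega u v = -(u ⬝ᵥ (Matrix.J (Fin 2) R *ᵥ v)) := by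
  simp [omega, dotProduct, Matrix.J, Matrix.mulVec, Fintype.sum_sum_type, Matrix.one_apply]
  ring

theorem omega_vecMul (M : Matrix (Fin 2 ⊕ Fin 2) (Fin 2 ⊕ Fin 2) R) (u v : Vec R) :
    omega (u ᵥ* M) (v ᵥ* M) = -(u ⬝ᵥ ((M * Matrix.J (Fin 2) R * Mᵀ) *ᵥ v)) := by
  rw [omega_eq_dotProduct_J, ← Matrix.mulVec_transpose M v, ← Matrix.dotProduct_mulVec,
    Matrix.mulVec_mulVec, Matrix.mulVec_mulVec]

theorem omega_vecMul_of_mem {M : Matrix (Fin 2 ⊕ Fin 2) (Fin 2 ⊕ Fin 2) R}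
    (hM : M ∈ Matrix.symplecticGroup (Fin 2) R) (u v : Vec R) :
    omega (u ᵥ* M) (v ᵥ* M) = omega u v := by
  rw [omega_vecMul, SymplecticGroup.mem_iff.1 hM, ← omega_eq_dotProduct_J]

theorem mem_symplecticGroup_of_omega {M : Matrix (Fin 2 ⊕ Fin 2) (Fin 2 ⊕ Fin 2) R}
    (hM : ∀ u v : Vec R, omega (u ᵥ* M) (v ᵥ* M) = omega u v) :
    M ∈ Matrix.symplecticGroup (Fin 2) R := by
  rw [SymplecticGroup.mem_iff]
  ext i j
  have := hM (Pi.single i 1) (Pi.single j 1)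
  rw [omega_vecMul, omega_eq_dotProduct_J, neg_inj] at this
  simpa using this

end Symplectic

/-! ### Maximality of Hecke groups -/

section HeckeGroup

variable {N : ℕ}

/-- A Hecke group contains every symplectic element commuting with all of its elements. -/
theorem IsHeckeGroup.mem_of_commute {A : Sp4 ℤ} {C : Subgroup (Sp4 (ZMod N))}
    (hC : IsHeckeGroup N A C) {B : Sp4 (ZMod N)} (hB : ∀ g ∈ C, g * B = B * g) : B ∈ C := by
  have hcomm : ∀ x ∈ insert B (C : Set (Sp4 (ZMod N))), ∀ y ∈ insert B (C : Set (Sp4 (ZMod N))),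
      x * y = y * x := by
    rintro x (rfl | hx) y (rfl | hy)
    · rfl
    · exact (hB y hy).symm
    · exact hB x hx
    · exact hC.1.1 x hx y hy
  -- `C` and `B` generate a commutative subgroup, which maximality forces into `C`.
  have := Subgroup.isMulCommutative_closure hcomm
  have hle : C ≤ Subgroup.closure (insert B (C : Set (Sp4 (ZMod N)))) := fun x hx =>
    Subgroup.subset_closure (Set.mem_insert_of_mem _ hx)
  refine hC.2 (y := Subgroup.closure (insert B (C : Set (Sp4 (ZMod N))))) ⟨?_, hle hC.1.2⟩ hle
    (Subgroup.subset_closure (Set.mem_insert _ _))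
  intro g hg h hh
  exact setLike_mul_comm hg hh

end HeckeGroup

/-! ### Quadratic algebra structure on the two planes -/

section FiniteField

variable {F : Type*} [Field F]

/-- A pair of vectors generating orthogonal planes on which `a` has the characteristic
polynomials `x² - τᵢ x + 1`. -/
structure IsCyclicPair {R : Type*} [CommRing R]
    (a : Matrix (Fin 2 ⊕ Fin 2) (Fin 2 ⊕ Fin 2) R) (τ₁ τ₂ : R) (v₁ v₂ : Vec R) : Prop where
  rel₁ : v₁ ᵥ* a ᵥ* a + v₁ = τ₁ • (v₁ ᵥ* a)
  rel₂ : v₂ ᵥ* a ᵥ* a + v₂ = τ₂ • (v₂ ᵥ* a)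
  omega_zero : omega v₁ v₂ = 0
  omega_left : omega (v₁ ᵥ* a) v₂ = 0
  omega_right : omega v₁ (v₂ ᵥ* a) = 0

/-- The traceless operator `2a - τ` on row vectors. -/
def traceless {R : Type*} [CommRing R] (a : Matrix (Fin 2 ⊕ Fin 2) (Fin 2 ⊕ Fin 2) R) (τ : R)
    (v : Vec R) : Vec R :=
  (2 : R) • (v ᵥ* a) - τ • v

/-- Completing the square in `a² - τ a + 1 = 0`: on a cyclic plane `2a - τ` is a square root of `δ =
τ² - 4`. -/
theorem traceless_traceless {R : Type*} [CommRing R]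
    {a : Matrix (Fin 2 ⊕ Fin 2) (Fin 2 ⊕ Fin 2) R} {τ : R} {v : Vec R}
    (h : v ᵥ* a ᵥ* a + v = τ • (v ᵥ* a)) :
    traceless a τ (traceless a τ v) = (τ ^ 2 - 4) • v := by
  have h' : v ᵥ* a ᵥ* a = τ • (v ᵥ* a) - v := eq_sub_of_add_eq h
  simp only [traceless, Matrix.sub_vecMul, Matrix.smul_vecMul, h']
  module

theorem cyclic_traceless {R : Type*} [CommRing R]
    {a : Matrix (Fin 2 ⊕ Fin 2) (Fin 2 ⊕ Fin 2) R} {τ : R} {v : Vec R}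
    (h : v ᵥ* a ᵥ* a + v = τ • (v ᵥ* a)) (x y : R) :
    (x • v + y • traceless a τ v) ᵥ* a ᵥ* a + (x • v + y • traceless a τ v) =
      τ • ((x • v + y • traceless a τ v) ᵥ* a) := by
  have h' : v ᵥ* a ᵥ* a = τ • (v ᵥ* a) - v := eq_sub_of_add_eq h
  simp only [traceless, Matrix.add_vecMul, Matrix.sub_vecMul, Matrix.smul_vecMul, h']
  module

/-- The coordinates defined by a cyclic pair. -/
def cyclicMap {R : Type*} [CommRing R] (a : Matrix (Fin 2 ⊕ Fin 2) (Fin 2 ⊕ Fin 2) R) (τ₁ τ₂ : R)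
    (v₁ v₂ : Vec R) : (R × R) × (R × R) →+ Vec R where
  toFun z := (z.1.1 • v₁ + z.1.2 • traceless a τ₁ v₁) + (z.2.1 • v₂ + z.2.2 • traceless a τ₂ v₂)
  map_zero' := by simp
  map_add' z z' := by simp only [Prod.fst_add, Prod.snd_add]; module

theorem cyclicMap_apply {R : Type*} [CommRing R] (a : Matrix (Fin 2 ⊕ Fin 2) (Fin 2 ⊕ Fin 2) R)
    (τ₁ τ₂ : R) (v₁ v₂ : Vec R) (z : (R × R) × (R × R)) :
    cyclicMap a τ₁ τ₂ v₁ v₂ z = (z.1.1 • v₁ + z.1.2 • traceless a τ₁ v₁) +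
      (z.2.1 • v₂ + z.2.2 • traceless a τ₂ v₂) := rfl

theorem IsCyclicPair.omega_cyclicMap {R : Type*} [CommRing R]
    {a : Matrix (Fin 2 ⊕ Fin 2) (Fin 2 ⊕ Fin 2) R}
    (ha : a ∈ Matrix.symplecticGroup (Fin 2) R) {τ₁ τ₂ : R} {v₁ v₂ : Vec R}
    (h : IsCyclicPair a τ₁ τ₂ v₁ v₂) (z z' : (R × R) × (R × R)) :
    omega (cyclicMap a τ₁ τ₂ v₁ v₂ z) (cyclicMap a τ₁ τ₂ v₁ v₂ z') =
      2 * omega (v₁ ᵥ* a) v₁ * bracket z.1 z'.1 + 2 * omega (v₂ ᵥ* a) v₂ * bracket z.2 z'.2 := by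
  have e (x y τ : R) (v : Vec R) : x • v + y • traceless a τ v =
      (x - y * τ) • v + (2 * y) • (v ᵥ* a) := by
    simp only [traceless]; module
  have h1 : omega v₂ v₁ = 0 := by rw [omega_swap_ring, h.omega_zero, neg_zero]
  have h2 : omega v₂ (v₁ ᵥ* a) = 0 := by rw [omega_swap_ring, h.omega_left, neg_zero]
  have h3 : omega (v₂ ᵥ* a) v₁ = 0 := by rw [omega_swap_ring, h.omega_right, neg_zero]
  simp only [cyclicMap_apply, e, omega_add_left_ring, omega_add_right_ring, omega_smul_left_ring,
    omega_smul_right_ring, omega_self_ring, omega_vecMul_of_mem ha, h.omega_zero, h.omega_left,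
    h.omega_right, h1, h2, h3, omega_swap_ring v₁ (v₁ ᵥ* a), omega_swap_ring v₂ (v₂ ᵥ* a), bracket]
  ring

/-- The polynomial in `a` (with inverse `a'`) acting on the two planes of a cyclic pair as
`α₁ + β₁ (2a - τ₁)` and `α₂ + β₂ (2a - τ₂)`. -/
noncomputable def planeMul (a a' : Matrix (Fin 2 ⊕ Fin 2) (Fin 2 ⊕ Fin 2) F) (τ₁ τ₂ : F)
    (g₁ g₂ : F × F) : Matrix (Fin 2 ⊕ Fin 2) (Fin 2 ⊕ Fin 2) F :=
  (τ₁ - τ₂)⁻¹ • ((a * a - τ₂ • a + 1) * a' * (g₁.1 • 1 + g₁.2 • ((2 : F) • a - τ₁ • 1)) -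
    (a * a - τ₁ • a + 1) * a' * (g₂.1 • 1 + g₂.2 • ((2 : F) • a - τ₂ • 1)))

theorem planeMul_swap {a a' : Matrix (Fin 2 ⊕ Fin 2) (Fin 2 ⊕ Fin 2) F} {τ₁ τ₂ : F}
    {g₁ g₂ : F × F} : planeMul a a' τ₁ τ₂ g₁ g₂ = planeMul a a' τ₂ τ₁ g₂ g₁ := by
  rw [planeMul, planeMul, ← neg_sub τ₂ τ₁, inv_neg, neg_smul, ← smul_neg, neg_sub]

/-- On the plane of `w` the polynomial `a² - τ₂ a + 1` equals `(τ₁ - τ₂) a`, while `a² - τ₁ a + 1`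
vanishes. After multiplication by `a⁻¹ / (τ₁ - τ₂)` the first becomes the identity there, so the
planes are separated by polynomials in `a` and `a⁻¹`. -/
theorem vecMul_planeMul {a a' : Matrix (Fin 2 ⊕ Fin 2) (Fin 2 ⊕ Fin 2) F} (haa : a * a' = 1)
    {τ₁ τ₂ : F} (hτ : τ₁ ≠ τ₂) {g₁ g₂ : F × F} {w : Vec F}
    (h : w ᵥ* a ᵥ* a + w = τ₁ • (w ᵥ* a)) :
    w ᵥ* planeMul a a' τ₁ τ₂ g₁ g₂ = g₁.1 • w + g₁.2 • traceless a τ₁ w := by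
  have h' : w ᵥ* a ᵥ* a = τ₁ • (w ᵥ* a) - w := eq_sub_of_add_eq h
  have hd : τ₁ - τ₂ ≠ 0 := sub_ne_zero.2 hτ
  have e1 : w ᵥ* (a * a - τ₂ • a + 1) = (τ₁ - τ₂) • (w ᵥ* a) := by
    rw [Matrix.vecMul_add, Matrix.vecMul_sub, ← Matrix.vecMul_vecMul, h', Matrix.vecMul_smul,
      Matrix.vecMul_one]
    module
  have e2 : w ᵥ* (a * a - τ₁ • a + 1) = 0 := by
    rw [Matrix.vecMul_add, Matrix.vecMul_sub, ← Matrix.vecMul_vecMul, h', Matrix.vecMul_smul,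
      Matrix.vecMul_one]
    module
  have e3 : w ᵥ* a ᵥ* a' = w := by rw [Matrix.vecMul_vecMul, haa, Matrix.vecMul_one]
  rw [planeMul, Matrix.vecMul_smul, Matrix.vecMul_sub, ← Matrix.vecMul_vecMul,
    ← Matrix.vecMul_vecMul, e1, ← Matrix.vecMul_vecMul, ← Matrix.vecMul_vecMul, e2,
    Matrix.smul_vecMul, e3, Matrix.zero_vecMul, Matrix.zero_vecMul, sub_zero, Matrix.smul_vecMul,
    smul_smul, inv_mul_cancel₀ hd, one_smul, Matrix.vecMul_add, Matrix.vecMul_smul,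
    Matrix.vecMul_smul, Matrix.vecMul_sub, Matrix.vecMul_smul, Matrix.vecMul_smul,
    Matrix.vecMul_one]
  rfl

theorem IsCyclicPair.cyclicMap_vecMul {a a' : Matrix (Fin 2 ⊕ Fin 2) (Fin 2 ⊕ Fin 2) F}
    (haa : a * a' = 1) {τ₁ τ₂ : F} (hτ : τ₁ ≠ τ₂) {v₁ v₂ : Vec F}
    (h : IsCyclicPair a τ₁ τ₂ v₁ v₂) (g₁ g₂ : F × F) (z : (F × F) × (F × F)) :
    cyclicMap a τ₁ τ₂ v₁ v₂ z ᵥ* planeMul a a' τ₁ τ₂ g₁ g₂ =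
      cyclicMap a τ₁ τ₂ v₁ v₂
        (quadMul (τ₁ ^ 2 - 4) z.1 g₁, quadMul (τ₂ ^ 2 - 4) z.2 g₂) := by
  have hlin (τ x y : F) (v : Vec F) : traceless a τ (x • v + y • traceless a τ v) =
      x • traceless a τ v + y • traceless a τ (traceless a τ v) := by
    simp only [traceless, Matrix.add_vecMul, Matrix.sub_vecMul, Matrix.smul_vecMul]
    module
  rw [cyclicMap_apply, Matrix.add_vecMul, vecMul_planeMul haa hτ (cyclic_traceless h.rel₁ _ _),
    planeMul_swap, vecMul_planeMul haa hτ.symm (cyclic_traceless h.rel₂ _ _), hlin, hlin,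
    traceless_traceless h.rel₁, traceless_traceless h.rel₂, cyclicMap_apply]
  simp only [quadMul]
  module

theorem commute_planeMul {a a' g : Matrix (Fin 2 ⊕ Fin 2) (Fin 2 ⊕ Fin 2) F} (h : Commute g a)
    (h' : Commute g a') (τ₁ τ₂ : F) (g₁ g₂ : F × F) : Commute g (planeMul a a' τ₁ τ₂ g₁ g₂) := by
  have hp (τ : F) : Commute g (a * a - τ • a + 1) :=
    ((h.mul_right h).sub_right (h.smul_right τ)).add_right (Commute.one_right g)
  have hx (τ : F) (k : F × F) : Commute g (k.1 • 1 + k.2 • ((2 : F) • a - τ • 1)) :=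
    ((Commute.one_right g).smul_right _).add_right
      (((h.smul_right _).sub_right ((Commute.one_right g).smul_right _)).smul_right _)
  exact ((((hp _).mul_right h').mul_right (hx _ _)).sub_right
    (((hp _).mul_right h').mul_right (hx _ _))).smul_right _

theorem nrm_quadMul_bracket {δ : F} {g z z' : F × F} (hg : nrm δ g = 1) :
    bracket (quadMul δ z g) (quadMul δ z' g) = bracket z z' := by
  simp only [nrm, bracket, quadMul] at hg ⊢
  linear_combination (z.2 * z'.1 - z.1 * z'.2) * hg

/-- Reduction modulo `N` of a cyclic pair gives a Hecke frame. -/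
theorem IsCyclicPair.exists_isHeckeFrame {N : ℕ} [Fact N.Prime] (h2 : (2 : ZMod N) ≠ 0)
    {A : Sp4 ℤ} {C : Subgroup (Sp4 (ZMod N))} (hC : IsHeckeGroup N A C) {τ₁ τ₂ : ZMod N}
    (hτ : τ₁ ≠ τ₂) {v₁ v₂ : Vec (ZMod N)} (h : IsCyclicPair (redSp N A).1 τ₁ τ₂ v₁ v₂)
    (h₁ : omega (v₁ ᵥ* (redSp N A).1) v₁ ≠ 0) (h₂ : omega (v₂ ᵥ* (redSp N A).1) v₂ ≠ 0) :
    ∃ e : (ZMod N × ZMod N) × (ZMod N × ZMod N) ≃+ Vec (ZMod N),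
      IsHeckeFrame C (τ₁ ^ 2 - 4) (τ₂ ^ 2 - 4) (2 * omega (v₁ ᵥ* (redSp N A).1) v₁)
        (2 * omega (v₂ ᵥ* (redSp N A).1) v₂) e ∧
      ∀ z, e z = cyclicMap (redSp N A).1 τ₁ τ₂ v₁ v₂ z := by
  set a := (redSp N A).1
  set a' := ((redSp N A)⁻¹).1
  have haa : a * a' = 1 := congrArg Subtype.val (mul_inv_cancel (redSp N A))
  have hom := h.omega_cyclicMap (redSp N A).2
  have hinj : Function.Injective (cyclicMap a τ₁ τ₂ v₁ v₂) := by
    rw [injective_iff_map_eq_zero]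
    intro z hz
    have h0 : ∀ z' : (ZMod N × ZMod N) × (ZMod N × ZMod N), 2 * omega (v₁ ᵥ* a) v₁ * bracket z.1 z'.1 +
        2 * omega (v₂ ᵥ* a) v₂ * bracket z.2 z'.2 = 0 := by
      intro z'
      rw [← hom, hz]
      simp [omega]
    have h3 := h0 ((1, 0), 0)
    have h4 := h0 ((0, 1), 0)
    have h5 := h0 (0, (1, 0))
    have h6 := h0 (0, (0, 1))
    simp only [bracket, Prod.fst_zero, Prod.snd_zero, mul_one, mul_zero, sub_zero, add_zero,
      zero_sub, zero_add, mul_eq_zero, h2, h₁, h₂, neg_eq_zero, false_or] at h3 h4 h5 h6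
    exact Prod.ext (Prod.ext h4 h3) (Prod.ext h6 h5)
  have hbij : Function.Bijective (cyclicMap a τ₁ τ₂ v₁ v₂) := by
    rw [Fintype.bijective_iff_injective_and_card]
    refine ⟨hinj, ?_⟩
    simp [ZMod.card]
    ring
  refine ⟨AddEquiv.ofBijective _ hbij, ⟨hom, ?_⟩, fun z => rfl⟩
  intro g₁ g₂ hg₁ hg₂
  have hact := h.cyclicMap_vecMul haa hτ g₁ g₂
  have hmem : planeMul a a' τ₁ τ₂ g₁ g₂ ∈ Matrix.symplecticGroup (Fin 2) (ZMod N) := by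
    refine mem_symplecticGroup_of_omega fun u v => ?_
    obtain ⟨z, rfl⟩ := hbij.2 u
    obtain ⟨z', rfl⟩ := hbij.2 v
    rw [hact, hact, hom, hom, nrm_quadMul_bracket hg₁, nrm_quadMul_bracket hg₂]
  -- Every element of `C` commutes with `A`, hence with this polynomial in `A` and `A⁻¹`. This is
  -- what makes the result uniform in the choice of Hecke group.
  refine ⟨⟨_, hmem⟩, hC.mem_of_commute fun g hg => Subtype.ext ?_, hact⟩
  have hga : g * redSp N A = redSp N A * g := hC.1.1 g hg _ hC.1.2
  have hga' : g * (redSp N A)⁻¹ = (redSp N A)⁻¹ * g := (Commute.inv_right (a := g) hga :)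
  exact commute_planeMul (congrArg Subtype.val hga) (congrArg Subtype.val hga') τ₁ τ₂ g₁ g₂

end FiniteField

/-! ### Invariant symplectic planes over the rationals -/

section Rational

theorem mem_spectrum_iff_exists_vecMul {K : Type*} [Field K]
    {M : Matrix (Fin 2 ⊕ Fin 2) (Fin 2 ⊕ Fin 2) K} {μ : K} :
    μ ∈ spectrum K M ↔ ∃ v ≠ 0, v ᵥ* M = μ • v := by
  rw [Matrix.mem_spectrum_iff_isRoot_charpoly, Polynomial.IsRoot, Matrix.eval_charpoly,
    ← Matrix.exists_vecMul_eq_zero_iff]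
  refine exists_congr fun v => and_congr_right fun _ => ?_
  rw [Matrix.vecMul_sub, sub_eq_zero, eq_comm, Matrix.scalar_apply, ← Matrix.smul_one_eq_diagonal,
    Matrix.vecMul_smul, Matrix.vecMul_one]

/-- A rational eigenvalue of an integer matrix is an integer. -/
theorem exists_int_eq_of_vecMul {M : Matrix (Fin 2 ⊕ Fin 2) (Fin 2 ⊕ Fin 2) ℤ} {v : Vec ℚ}
    (hv : v ≠ 0) {μ : ℚ} (h : v ᵥ* M.map (Int.cast : ℤ → ℚ) = μ • v) : ∃ k : ℤ, (k : ℚ) = μ := by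
  have hr := Matrix.mem_spectrum_iff_isRoot_charpoly.1
    (mem_spectrum_iff_exists_vecMul.2 ⟨v, hv, h⟩)
  have hc : (M.map (Int.cast : ℤ → ℚ)).charpoly = M.charpoly.map (Int.castRingHom ℚ) :=
    M.charpoly_map (Int.castRingHom ℚ)
  rw [hc, Polynomial.IsRoot, Polynomial.eval_map] at hr
  have hi : IsIntegral ℤ μ := ⟨M.charpoly, M.charpoly_monic, hr⟩
  exact IsIntegrallyClosed.isIntegral_iff.1 hi

theorem map_mul_map_inv {R : Type*} [CommRing R] (A : Sp4 ℤ) :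
    A.1.map (Int.cast : ℤ → R) * (A⁻¹).1.map (Int.cast : ℤ → R) = 1 := by
  have h : A.1 * (A⁻¹).1 = 1 := congrArg Subtype.val (mul_inv_cancel A)
  have := congrArg (fun M => M.map (Int.castRingHom R)) h
  simp only [Matrix.map_mul] at this
  rw [Matrix.map_one _ (map_zero _) (map_one _)] at this
  exact this

theorem vecMul_map_inv {R : Type*} [CommRing R] (A : Sp4 ℤ) (v : Vec R) :
    v ᵥ* A.1.map (Int.cast : ℤ → R) ᵥ* (A⁻¹).1.map (Int.cast : ℤ → R) = v := by
  rw [Matrix.vecMul_vecMul, map_mul_map_inv, Matrix.vecMul_one]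

theorem map_mem_symplecticGroup {R : Type*} [CommRing R] (A : Sp4 ℤ) :
    A.1.map (Int.cast : ℤ → R) ∈ Matrix.symplecticGroup (Fin 2) R :=
  SymplecticGroup.map_mem (f := Int.castRingHom R) A.2

/-- A rational eigenvalue of `A` and its inverse, an eigenvalue of `A⁻¹`, are both integers. The
eigenvalue is then `±1`, a root of unity. -/
theorem vecMul_map_ne_smul {A : Sp4 ℤ}
    (hroot : ∀ μ ∈ spectrum ℂ (A.1.map (Int.cast : ℤ → ℂ)), ∀ k : ℕ, 0 < k → μ ^ k ≠ 1)
    {v : Vec ℚ} (hv : v ≠ 0) (μ : ℚ) : v ᵥ* A.1.map (Int.cast : ℤ → ℚ) ≠ μ • v := by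
  intro h
  obtain ⟨k, hk⟩ := exists_int_eq_of_vecMul hv h
  have hinv := vecMul_map_inv A v
  rw [h, Matrix.smul_vecMul] at hinv
  have hμ : μ ≠ 0 := by
    rintro rfl
    rw [zero_smul] at hinv
    exact hv hinv.symm
  have h' : v ᵥ* (A⁻¹).1.map (Int.cast : ℤ → ℚ) = μ⁻¹ • v := by
    conv_rhs => rw [← hinv]
    rw [smul_smul, inv_mul_cancel₀ hμ, one_smul]
  obtain ⟨l, hl⟩ := exists_int_eq_of_vecMul hv h'
  have hkl : k * l = 1 := by
    have : (k : ℚ) * l = 1 := by rw [hk, hl, mul_inv_cancel₀ hμ]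
    exact_mod_cast this
  have hk2 : k ^ 2 = 1 := by
    rcases Int.eq_one_or_neg_one_of_mul_eq_one hkl with rfl | rfl <;> norm_num
  refine hroot (k : ℂ) (mem_spectrum_iff_exists_vecMul.2 ⟨fun i => (v i : ℂ), ?_, ?_⟩) 2
    (by norm_num) (by exact_mod_cast hk2)
  · intro h0
    refine hv (funext fun i => ?_)
    have := congrFun h0 i
    simpa using this
  · funext i
    have := congrArg (fun x : ℚ => (x : ℂ)) (congrFun h i)
    rw [← hk] at this
    simp only [Matrix.vecMul, dotProduct, Matrix.map_apply, Pi.smul_apply, smul_eq_mul] at this ⊢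
    push_cast at this
    exact this

variable {A : Sp4 ℤ} {V : Submodule ℚ (Vec ℚ)}

/-- The matrix `A` over `ℚ`. -/
abbrev ratMat (A : Sp4 ℤ) : Matrix (Fin 2 ⊕ Fin 2) (Fin 2 ⊕ Fin 2) ℚ :=
  A.1.map (Int.cast : ℤ → ℚ)

theorem linearIndependent_pair (hA : ∀ v : Vec ℚ, v ≠ 0 → ∀ μ : ℚ, v ᵥ* ratMat A ≠ μ • v) {u : Vec ℚ}
    (hu : u ≠ 0) : LinearIndependent ℚ ![u, u ᵥ* ratMat A] := by
  rw [LinearIndependent.pair_iff' hu]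
  exact fun μ h => hA u hu μ h.symm

theorem two_le_finrank (hA : ∀ v : Vec ℚ, v ≠ 0 → ∀ μ : ℚ, v ᵥ* ratMat A ≠ μ • v)
    (hinv : IsInvariantSubspace A V) (hne : V ≠ ⊥) : 2 ≤ Module.finrank ℚ V := by
  obtain ⟨u, huV, hu⟩ := Submodule.exists_mem_ne_zero_of_ne_bot hne
  have h := finrank_span_eq_card (linearIndependent_pair hA hu)
  simp only [Fintype.card_fin, Nat.succ_eq_add_one, zero_add, Nat.reduceAdd] at h
  refine h.ge.trans (Submodule.finrank_mono (Submodule.span_le.2 ?_))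
  rintro _ ⟨i, rfl⟩
  fin_cases i
  · exact huV
  · exact hinv u huV

theorem exists_eq_combination (hA : ∀ v : Vec ℚ, v ≠ 0 → ∀ μ : ℚ, v ᵥ* ratMat A ≠ μ • v)
    (hinv : IsInvariantSubspace A V) (hrank : Module.finrank ℚ V = 2) {u : Vec ℚ} (huV : u ∈ V)
    (hu : u ≠ 0) {w : Vec ℚ} (hw : w ∈ V) : ∃ x y : ℚ, w = x • u + y • (u ᵥ* ratMat A) := by
  have h := finrank_span_eq_card (linearIndependent_pair hA hu)
  simp only [Fintype.card_fin, Nat.succ_eq_add_one, zero_add, Nat.reduceAdd] at h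
  have hle : Submodule.span ℚ (Set.range ![u, u ᵥ* ratMat A]) ≤ V := by
    refine Submodule.span_le.2 ?_
    rintro _ ⟨i, rfl⟩
    fin_cases i
    · exact huV
    · exact hinv u huV
  have heq := Submodule.eq_of_le_of_finrank_eq hle (h.trans hrank.symm)
  rw [← heq, Matrix.range_cons_cons_empty, Submodule.mem_span_pair] at hw
  obtain ⟨x, y, h⟩ := hw
  exact ⟨x, y, h.symm⟩

/-- `u` and `u A` span the plane, so `ω(u A, u) = 0` would put `u` in the radical. -/
theorem omega_vecMul_ne_zero (hA : ∀ v : Vec ℚ, v ≠ 0 → ∀ μ : ℚ, v ᵥ* ratMat A ≠ μ • v)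
    (hinv : IsInvariantSubspace A V) (hsymp : IsSymplecticSubspace V)
    (hrank : Module.finrank ℚ V = 2) {u : Vec ℚ} (huV : u ∈ V) (hu : u ≠ 0) :
    omega (u ᵥ* ratMat A) u ≠ 0 := by
  intro h
  refine hu (hsymp u huV fun w hw => ?_)
  obtain ⟨x, y, rfl⟩ := exists_eq_combination hA hinv hrank huV hu hw
  rw [omega_add_right_ring, omega_smul_right_ring, omega_smul_right_ring, omega_self_ring,
    omega_swap_ring, h]
  ring

/-- On an invariant symplectic plane `A` has characteristic polynomial `x² - τ x + 1` with an
integer `τ`, `τ² ≠ 4`. -/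
theorem exists_trace (hA : ∀ v : Vec ℚ, v ≠ 0 → ∀ μ : ℚ, v ᵥ* ratMat A ≠ μ • v)
    (hinv : IsInvariantSubspace A V) (hsymp : IsSymplecticSubspace V)
    (hrank : Module.finrank ℚ V = 2) :
    ∃ τ : ℤ, τ ^ 2 - 4 ≠ 0 ∧ ∀ w ∈ V, w ᵥ* ratMat A ᵥ* ratMat A + w = (τ : ℚ) • (w ᵥ* ratMat A) := by
  have hne : V ≠ ⊥ := by
    rintro rfl
    simp at hrank
  obtain ⟨u, huV, hu⟩ := Submodule.exists_mem_ne_zero_of_ne_bot hne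
  obtain ⟨x, y, hxy⟩ := exists_eq_combination hA hinv hrank huV hu (hinv _ (hinv u huV))
  have hq := omega_vecMul_ne_zero hA hinv hsymp hrank huV hu
  -- Invariance of `ω(u A, u)` under `A` says that `A` has determinant one on the plane.
  have hx : x = -1 := by
    have h1 : omega (u ᵥ* ratMat A ᵥ* ratMat A) (u ᵥ* ratMat A) = omega (u ᵥ* ratMat A) u :=
      omega_vecMul_of_mem (map_mem_symplecticGroup A) _ _
    rw [hxy, omega_add_left_ring, omega_smul_left_ring, omega_smul_left_ring, omega_self_ring,
      omega_swap_ring u] at h1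
    have : (x + 1) * omega (u ᵥ* ratMat A) u = 0 := by linear_combination -h1
    rcases mul_eq_zero.1 this with h | h
    · linear_combination h
    · exact absurd h hq
  have hrel : u ᵥ* ratMat A ᵥ* ratMat A + u = y • (u ᵥ* ratMat A) := by
    rw [hxy, hx]
    module
  -- `y` is an eigenvalue of the integer matrix `A + A⁻¹`, hence an integer.
  obtain ⟨τ, rfl⟩ : ∃ k : ℤ, (k : ℚ) = y := by
    refine exists_int_eq_of_vecMul (M := A.1 + (A⁻¹).1) hu ?_
    have h1 := congrArg (fun v => v ᵥ* (A⁻¹).1.map (Int.cast : ℤ → ℚ)) hrel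
    simp only [Matrix.add_vecMul, Matrix.smul_vecMul, vecMul_map_inv] at h1
    rw [← h1, Matrix.map_add _ Int.cast_add, Matrix.vecMul_add]
  refine ⟨τ, fun h4 => ?_, fun w hw => ?_⟩
  · have hτ : (τ - 2) * (τ + 2) = 0 := by linear_combination h4
    -- If `τ = 2s` with `s = ±1`, then `(A - s)² = 0` on the plane and `u A - s u` would be a
    -- rational eigenvector.
    have key : ∀ s : ℚ, s * s = 1 → (τ : ℚ) = 2 * s → False := by
      intro s hs hτs
      have hw : u ᵥ* ratMat A - s • u ≠ 0 := fun h => hA u hu s (sub_eq_zero.1 h)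
      refine hA _ hw s ?_
      have e : u ᵥ* ratMat A ᵥ* ratMat A = (2 * s) • (u ᵥ* ratMat A) - u := by
        rw [← hτs]; exact eq_sub_of_add_eq hrel
      rw [Matrix.sub_vecMul, Matrix.smul_vecMul, e, smul_sub, smul_smul, hs]
      module
    rcases mul_eq_zero.1 hτ with h | h
    · exact key 1 (by norm_num) (by
        have : τ = 2 := by linear_combination h
        rw [this]; norm_num)
    · exact key (-1) (by norm_num) (by
        have : τ = -2 := by linear_combination h
        rw [this]; norm_num)
  · obtain ⟨a, b, rfl⟩ := exists_eq_combination hA hinv hrank huV hu hw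
    have e : u ᵥ* ratMat A ᵥ* ratMat A = (τ : ℚ) • (u ᵥ* ratMat A) - u := eq_sub_of_add_eq hrel
    simp only [Matrix.add_vecMul, Matrix.smul_vecMul, e, Matrix.sub_vecMul]
    module

/-- A matrix annihilated by a quadratic polynomial has at most two eigenvalues. -/
theorem spectrum_ncard_le_two {M : Matrix (Fin 2 ⊕ Fin 2) (Fin 2 ⊕ Fin 2) ℂ} {τ : ℂ}
    (h : M * M + 1 = τ • M) : (spectrum ℂ M).ncard ≤ 2 := by
  have hroot : ∀ μ ∈ spectrum ℂ M, μ ^ 2 - τ * μ + 1 = 0 := by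
    intro μ hμ
    obtain ⟨v, hv, hvμ⟩ := mem_spectrum_iff_exists_vecMul.1 hμ
    have h1 := congrArg (fun X => v ᵥ* X) h
    simp only [Matrix.vecMul_add, ← Matrix.vecMul_vecMul, hvμ, Matrix.smul_vecMul,
      Matrix.vecMul_one, Matrix.vecMul_smul] at h1
    have h3 : (μ ^ 2 - τ * μ + 1) • v = 0 := by
      have : (μ ^ 2 - τ * μ + 1) • v = (μ • μ • v + v) - τ • μ • v := by module
      rw [this, h1, sub_self]
    exact (smul_eq_zero.1 h3).resolve_right hv
  rcases (spectrum ℂ M).eq_empty_or_nonempty with he | ⟨μ, hμ⟩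
  · simp [he]
  · refine (Set.ncard_le_ncard (t := {μ, τ - μ}) (fun ν hν => ?_) (Set.toFinite _)).trans
      ((Set.ncard_insert_le _ _).trans (by rw [Set.ncard_singleton]))
    have : (ν - μ) * (ν - (τ - μ)) = 0 := by
      linear_combination hroot ν hν - hroot μ hμ
    simpa [sub_eq_zero] using this

theorem spectrum_ncard_le_two_of_vecMul {τ : ℤ}
    (h : ∀ w : Vec ℚ, w ᵥ* ratMat A ᵥ* ratMat A + w = (τ : ℚ) • (w ᵥ* ratMat A)) :
    (spectrum ℂ (A.1.map (Int.cast : ℤ → ℂ))).ncard ≤ 2 := by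
  have hQ : A.1.map (Int.cast : ℤ → ℚ) * A.1.map (Int.cast : ℤ → ℚ) + 1 =
      (τ : ℚ) • A.1.map (Int.cast : ℤ → ℚ) := by
    refine Matrix.ext_of_single_vecMul fun i => ?_
    rw [Matrix.vecMul_add, ← Matrix.vecMul_vecMul, Matrix.vecMul_one, Matrix.vecMul_smul]
    exact h _
  refine spectrum_ncard_le_two (τ := τ) ?_
  have := congrArg (fun M => M.map (Rat.castHom ℂ)) hQ
  ext i j
  have hij := congrFun (congrFun this i) j
  simp only [Matrix.map_apply, Matrix.add_apply, Matrix.mul_apply, Matrix.smul_apply, map_add,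
    map_sum, map_mul, map_intCast, smul_eq_mul, Matrix.one_apply] at hij ⊢
  rw [← hij]
  congr 1
  split_ifs <;> simp

end Rational

/-! ### Integral cyclic vectors adapted to `n` -/

section Integral

theorem omega_map {R S : Type*} [CommRing R] [CommRing S] (f : R →+* S) (u v : Vec R) :
    omega (f ∘ u) (f ∘ v) = f (omega u v) := by
  simp [omega, dotProduct]

theorem vecMul_comp {R S : Type*} [CommRing R] [CommRing S] (f : R →+* S)
    (a : Matrix (Fin 2 ⊕ Fin 2) (Fin 2 ⊕ Fin 2) R) (v : Vec R) :
    (f ∘ v) ᵥ* a.map f = f ∘ (v ᵥ* a) :=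
  funext fun i => (f.map_vecMul a v i).symm

theorem cyclic_map_iff {R S : Type*} [CommRing R] [CommRing S] {f : R →+* S}
    (hf : Function.Injective f) {a : Matrix (Fin 2 ⊕ Fin 2) (Fin 2 ⊕ Fin 2) R} {τ : R}
    {v : Vec R} : (f ∘ v) ᵥ* a.map f ᵥ* a.map f + f ∘ v = f τ • ((f ∘ v) ᵥ* a.map f) ↔
      v ᵥ* a ᵥ* a + v = τ • (v ᵥ* a) := by
  rw [vecMul_comp, vecMul_comp]
  have : f ∘ (v ᵥ* a ᵥ* a) + f ∘ v = f τ • (f ∘ (v ᵥ* a)) ↔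
      f ∘ (v ᵥ* a ᵥ* a + v) = f ∘ (τ • (v ᵥ* a)) := by
    simp [funext_iff]
  rw [this]
  exact (hf.comp_left).eq_iff

theorem IsCyclicPair.map {R S : Type*} [CommRing R] [CommRing S] (f : R →+* S)
    {a : Matrix (Fin 2 ⊕ Fin 2) (Fin 2 ⊕ Fin 2) R} {τ₁ τ₂ : R} {v₁ v₂ : Vec R}
    (h : IsCyclicPair a τ₁ τ₂ v₁ v₂) :
    IsCyclicPair (a.map f) (f τ₁) (f τ₂) (f ∘ v₁) (f ∘ v₂) := by
  have hrel {τ : R} {v : Vec R} (h : v ᵥ* a ᵥ* a + v = τ • (v ᵥ* a)) :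
      f ∘ (v ᵥ* a ᵥ* a) + f ∘ v = f τ • (f ∘ (v ᵥ* a)) := by
    have h' := congrArg (fun w => f ∘ w) h
    funext i
    simpa using congrFun h' i
  constructor <;> simp only [vecMul_comp, omega_map]
  · exact hrel h.rel₁
  · exact hrel h.rel₂
  · rw [h.omega_zero, map_zero]
  · rw [h.omega_left, map_zero]
  · rw [h.omega_right, map_zero]

theorem exists_common_denominator (u v : Vec ℚ) : ∃ d : ℤ, d ≠ 0 ∧ ∃ b c : Vec ℤ,
    Int.castRingHom ℚ ∘ b = (d : ℚ) • u ∧ Int.castRingHom ℚ ∘ c = (d : ℚ) • v := by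
  obtain ⟨d, hd⟩ := IsLocalization.exist_integer_multiples_of_finite (nonZeroDivisors ℤ)
    (Sum.elim u v)
  choose b hb using fun i => hd (Sum.inl i)
  choose c hc using fun i => hd (Sum.inr i)
  refine ⟨d, nonZeroDivisors.coe_ne_zero d, b, c, funext fun i => ?_, funext fun i => ?_⟩
  · simpa using hb i
  · simpa using hc i

/-- The cyclic vectors are multiples of the components of `n` wherever these are nonzero. The
coordinates of `n` in the frame are then `εᵢ / d` along the generators, so modulo a good prime a
nonzero component has nonzero norm. -/
theorem exists_integral_pair {A : Sp4 ℤ}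
    (hdist : (spectrum ℂ (A.1.map (Int.cast : ℤ → ℂ))).ncard = 4)
    (hroot : ∀ μ ∈ spectrum ℂ (A.1.map (Int.cast : ℤ → ℂ)), ∀ k : ℕ, 0 < k → μ ^ k ≠ 1)
    {V₁ V₂ : Submodule ℚ (Vec ℚ)} (hV : IsSymplecticDecomposition A V₁ V₂) (n : Vec ℤ) :
    ∃ (τ₁ τ₂ d ε₁ ε₂ : ℤ) (b₁ b₂ : Vec ℤ), IsCyclicPair A.1 τ₁ τ₂ b₁ b₂ ∧ τ₁ ≠ τ₂ ∧
      τ₁ ^ 2 - 4 ≠ 0 ∧ τ₂ ^ 2 - 4 ≠ 0 ∧ omega (b₁ ᵥ* A.1) b₁ ≠ 0 ∧ omega (b₂ ᵥ* A.1) b₂ ≠ 0 ∧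
      d ≠ 0 ∧ d • n = ε₁ • b₁ + ε₂ • b₂ ∧ (ε₁ = 0 ∨ ε₁ = 1) ∧ (ε₂ = 0 ∨ ε₂ = 1) ∧
      (n ∈ latticeOf V₁ ↔ ε₂ = 0) ∧ (n ∈ latticeOf V₂ ↔ ε₁ = 0) := by
  have hA : ∀ v : Vec ℚ, v ≠ 0 → ∀ μ : ℚ, v ᵥ* ratMat A ≠ μ • v := fun v hv μ =>
    vecMul_map_ne_smul hroot hv μ
  have hf₁ := two_le_finrank hA hV.invariant₁ hV.ne_bot₁
  have hf₂ := two_le_finrank hA hV.invariant₂ hV.ne_bot₂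
  have hf := Submodule.finrank_add_eq_of_isCompl hV.isCompl
  rw [Module.finrank_fintype_fun_eq_card, Fintype.card_sum, Fintype.card_fin] at hf
  have hr₁ : Module.finrank ℚ V₁ = 2 := by omega
  have hr₂ : Module.finrank ℚ V₂ = 2 := by omega
  obtain ⟨τ₁, hτ₁, hc₁⟩ := exists_trace hA hV.invariant₁ hV.symplectic₁ hr₁
  obtain ⟨τ₂, hτ₂, hc₂⟩ := exists_trace hA hV.invariant₂ hV.symplectic₂ hr₂
  have hdecomp : ∀ w : Vec ℚ, ∃ w₁ ∈ V₁, ∃ w₂ ∈ V₂, w₁ + w₂ = w := fun w =>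
    Submodule.mem_sup.1 (hV.isCompl.sup_eq_top ▸ Submodule.mem_top)
  -- Equal traces would make `A` a root of a single quadratic polynomial, leaving at most two
  -- distinct eigenvalues instead of four.
  have hne : τ₁ ≠ τ₂ := by
    rintro rfl
    have := spectrum_ncard_le_two_of_vecMul (A := A) (τ := τ₁) fun w => by
      obtain ⟨w₁, h₁, w₂, h₂, rfl⟩ := hdecomp w
      simp only [Matrix.add_vecMul, smul_add]
      rw [← hc₁ w₁ h₁, ← hc₂ w₂ h₂]
      abel
    omega
  set ι : ℤ →+* ℚ := Int.castRingHom ℚ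
  have hι : Function.Injective ι := Int.cast_injective
  obtain ⟨n₁, hn₁, n₂, hn₂, hn⟩ := hdecomp (ι ∘ n)
  -- A zero component cannot generate its plane; any nonzero vector replaces it, with coefficient `ε
  -- = 0`.
  have hchoice : ∀ {V : Submodule ℚ (Vec ℚ)}, V ≠ ⊥ → ∀ m ∈ V, ∃ u ∈ V, ∃ ε : ℤ, u ≠ 0 ∧
      (ε = 0 ∨ ε = 1) ∧ m = (ε : ℚ) • u ∧ (m = 0 ↔ ε = 0) := by
    intro V hVne m hm
    by_cases h0 : m = 0
    · obtain ⟨u, hu, hu0⟩ := Submodule.exists_mem_ne_zero_of_ne_bot hVne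
      exact ⟨u, hu, 0, hu0, Or.inl rfl, by simp [h0], by simp [h0]⟩
    · exact ⟨m, hm, 1, h0, Or.inr rfl, by simp, by simp [h0]⟩
  obtain ⟨u₁, hu₁, ε₁, hu₁0, hε₁, hm₁, hz₁⟩ := hchoice hV.ne_bot₁ n₁ hn₁
  obtain ⟨u₂, hu₂, ε₂, hu₂0, hε₂, hm₂, hz₂⟩ := hchoice hV.ne_bot₂ n₂ hn₂
  obtain ⟨d, hd, b₁, b₂, hb₁, hb₂⟩ := exists_common_denominator u₁ u₂
  change ι ∘ b₁ = _ at hb₁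
  change ι ∘ b₂ = _ at hb₂
  have hdQ : (d : ℚ) ≠ 0 := Int.cast_ne_zero.2 hd
  have hbV₁ : ι ∘ b₁ ∈ V₁ := hb₁ ▸ V₁.smul_mem _ hu₁
  have hbV₂ : ι ∘ b₂ ∈ V₂ := hb₂ ▸ V₂.smul_mem _ hu₂
  have hb₁0 : ι ∘ b₁ ≠ 0 := hb₁ ▸ smul_ne_zero hdQ hu₁0
  have hb₂0 : ι ∘ b₂ ≠ 0 := hb₂ ▸ smul_ne_zero hdQ hu₂0
  have hvec : ∀ b : Vec ℤ, (ι ∘ b) ᵥ* ratMat A = ι ∘ (b ᵥ* A.1) := vecMul_comp ι A.1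
  have hom : ∀ {b c : Vec ℤ}, omega (ι ∘ b) (ι ∘ c) = 0 → omega b c = 0 := fun h =>
    hι (by rw [← omega_map, h, map_zero])
  have hdisj := Submodule.disjoint_def.1 hV.isCompl.disjoint
  refine ⟨τ₁, τ₂, d, ε₁, ε₂, b₁, b₂, ⟨?_, ?_, ?_, ?_, ?_⟩, hne, hτ₁, hτ₂, ?_, ?_, hd, ?_, hε₁, hε₂,
    ?_, ?_⟩
  · exact (cyclic_map_iff hι).1 (hc₁ _ hbV₁)
  · exact (cyclic_map_iff hι).1 (hc₂ _ hbV₂)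
  · exact hom (hV.orthogonal _ hbV₁ _ hbV₂)
  · exact hom (by rw [← hvec]; exact hV.orthogonal _ (hV.invariant₁ _ hbV₁) _ hbV₂)
  · exact hom (by rw [← hvec]; exact hV.orthogonal _ hbV₁ _ (hV.invariant₂ _ hbV₂))
  · intro h
    refine omega_vecMul_ne_zero hA hV.invariant₁ hV.symplectic₁ hr₁ hbV₁ hb₁0 ?_
    rw [hvec, omega_map, h, map_zero]
  · intro h
    refine omega_vecMul_ne_zero hA hV.invariant₂ hV.symplectic₂ hr₂ hbV₂ hb₂0 ?_
    rw [hvec, omega_map, h, map_zero]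
  · refine hι.comp_left ?_
    have e : ι ∘ (d • n) = (d : ℚ) • (ι ∘ n) := by funext i; simp [ι]
    have e' : ι ∘ (ε₁ • b₁ + ε₂ • b₂) = (ε₁ : ℚ) • (ι ∘ b₁) + (ε₂ : ℚ) • (ι ∘ b₂) := by
      funext i; simp [ι]
    simp only [e, e', hb₁, hb₂, ← hn, hm₁, hm₂]
    module
  · rw [← hz₂]
    have : n ∈ latticeOf V₁ ↔ ι ∘ n ∈ V₁ := Iff.rfl
    rw [this, ← hn]
    constructor
    · intro h
      exact hdisj _ ((V₁.add_mem_iff_right hn₁).1 h) hn₂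
    · intro h
      rwa [h, add_zero]
  · rw [← hz₁]
    have : n ∈ latticeOf V₂ ↔ ι ∘ n ∈ V₂ := Iff.rfl
    rw [this, ← hn]
    constructor
    · intro h
      exact hdisj _ hn₁ ((V₂.add_mem_iff_left hn₂).1 h)
    · intro h
      rwa [h, zero_add]

end Integral

end CatMap

/-! ### Good primes and conclusion -/

theorem theorem1 (A : CatMap.Sp4 ℤ)
    (hA : A.1.map (Int.cast : ℤ → ZMod 2) = 1)
    (hdist : (spectrum ℂ (A.1.map (Int.cast : ℤ → ℂ))).ncard = 4)
    (hroot : ∀ μ ∈ spectrum ℂ (A.1.map (Int.cast : ℤ → ℂ)),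
      ∀ k : ℕ, 0 < k → μ ^ k ≠ 1)
    (V₁ V₂ : Submodule ℚ (CatMap.Vec ℚ)) (hV : CatMap.IsSymplecticDecomposition A V₁ V₂)
    (n : CatMap.Vec ℤ) (hn : n ≠ 0) :
    ∃ (K : ℝ) (N₀ : ℕ), ∀ (N : ℕ) [NeZero N], N.Prime → N₀ ≤ N →
      ∀ C : Subgroup (CatMap.Sp4 (ZMod N)), CatMap.IsHeckeGroup N A C →
      ∀ φ : Module.Basis (Fin (N ^ 2)) ℂ (CatMap.State N), CatMap.IsHeckeBasis C φ →
        (n ∈ CatMap.latticeOf V₁ ∪ CatMap.latticeOf V₂ →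
          |CatMap.S2 (UnitAddTorus.mFourier n) N φ - 1 / (N : ℝ)| ≤ K / (N : ℝ) ^ 2) ∧
        (n ∉ CatMap.latticeOf V₁ ∪ CatMap.latticeOf V₂ →
          |CatMap.S2 (UnitAddTorus.mFourier n) N φ - 1 / (N : ℝ) ^ 2| ≤ K / (N : ℝ) ^ 3) := by
  obtain ⟨τ₁, τ₂, d, ε₁, ε₂, b₁, b₂, hpair, hτ, hδ₁, hδ₂, hq₁, hq₂, hd, hdn, hε₁, hε₂, hL₁, hL₂⟩ :=
    CatMap.exists_integral_pair hdist hroot hV n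
  -- The primes to be avoided are the divisors of `D`: away from them the planes stay complementary
  -- and symplectic, the traces distinct, the discriminants nonzero, and `2` and `d` invertible.
  -- Every prime above `|D|` is good, whatever the Hecke group or basis.
  set D : ℤ := 2 * d * (τ₁ - τ₂) * (τ₁ ^ 2 - 4) * (τ₂ ^ 2 - 4) *
    CatMap.omega (b₁ ᵥ* A.1) b₁ * CatMap.omega (b₂ ᵥ* A.1) b₂ with hDdef
  have hD : D ≠ 0 := by
    simp only [hDdef, ne_eq, mul_eq_zero, sub_eq_zero (a := τ₁), hd, hτ, hδ₁, hδ₂, hq₁, hq₂]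
    norm_num
  refine ⟨100, D.natAbs + 1, fun N _ hN hN₀ C hC φ hφ => ?_⟩
  have : Fact N.Prime := ⟨hN⟩
  set f : ℤ →+* ZMod N := Int.castRingHom (ZMod N)
  have hDN : f D ≠ 0 := by
    intro h
    have hdvd : (N : ℤ) ∣ D := (ZMod.intCast_zmod_eq_zero_iff_dvd D N).1 h
    have := Nat.le_of_dvd (Int.natAbs_pos.2 hD) (Int.natCast_dvd.1 hdvd)
    omega
  simp only [hDdef, map_mul, mul_ne_zero_iff] at hDN
  obtain ⟨⟨⟨⟨⟨⟨h2, hdN⟩, hτN⟩, hδ₁N⟩, hδ₂N⟩, hq₁N⟩, hq₂N⟩ := hDN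
  have h2N : (2 : ZMod N) ≠ 0 := by rwa [map_ofNat] at h2
  have hτN' : f τ₁ ≠ f τ₂ := by rwa [map_sub, sub_ne_zero] at hτN
  simp only [map_sub, map_pow, map_ofNat] at hδ₁N hδ₂N
  have hpairN : CatMap.IsCyclicPair (CatMap.redSp N A).1 (f τ₁) (f τ₂) (f ∘ b₁) (f ∘ b₂) :=
    hpair.map f
  have hom : ∀ b : CatMap.Vec ℤ, CatMap.omega ((f ∘ b) ᵥ* (CatMap.redSp N A).1) (f ∘ b) =
      f (CatMap.omega (b ᵥ* A.1) b) := by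
    intro b
    rw [← CatMap.omega_map, ← CatMap.vecMul_comp]
    rfl
  obtain ⟨e, he, hecoe⟩ := hpairN.exists_isHeckeFrame h2N hC hτN' (by rwa [hom]) (by rwa [hom])
  rw [hom, hom] at he
  have hz : CatMap.redVec N n = e ((f ε₁ * (f d)⁻¹, 0), (f ε₂ * (f d)⁻¹, 0)) := by
    have h1 : f d • CatMap.redVec N n = f ε₁ • (f ∘ b₁) + f ε₂ • (f ∘ b₂) := by
      funext i
      have := congrArg f (congrFun hdn i)
      simpa [CatMap.redVec] using this
    rw [hecoe, CatMap.cyclicMap_apply, ← one_smul (ZMod N) (CatMap.redVec N n),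
      ← inv_mul_cancel₀ hdN, ← smul_smul, h1]
    module
  obtain ⟨hS₁, hS₂, hS₁₂⟩ := he.abs_S2_sub_le h2N hδ₁N hδ₂N (mul_ne_zero h2N hq₁N)
    (mul_ne_zero h2N hq₂N) hφ hn hz
  -- The component lies along the generator, so its norm is the square `d⁻²` for every `δ`.
  have hnrm : ∀ (δ : ZMod N) {ε : ℤ}, ε = 1 → CatMap.nrm δ (f ε * (f d)⁻¹, 0) ≠ 0 := by
    rintro δ ε rfl
    simpa [CatMap.nrm] using hdN
  have hnot : ¬ (ε₁ = 0 ∧ ε₂ = 0) := by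
    rintro ⟨rfl, rfl⟩
    simp only [zero_smul, add_zero] at hdn
    exact (smul_ne_zero hd hn) hdn
  constructor
  · rintro (h | h)
    · have h0 := hL₁.1 h
      have h1 : ε₁ = 1 := hε₁.resolve_left fun h => hnot ⟨h, h0⟩
      exact hS₁ (hnrm _ h1) (by simp [h0])
    · have h0 := hL₂.1 h
      have h1 : ε₂ = 1 := hε₂.resolve_left fun h => hnot ⟨h0, h⟩
      exact hS₂ (by simp [h0]) (hnrm _ h1)
  · intro h
    rw [Set.mem_union, not_or, hL₁, hL₂] at h
    exact hS₁₂ (hnrm _ (hε₁.resolve_left h.2)) (hnrm _ (hε₂.resolve_left h.1))
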